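/- **Theorem 9 (regret of CUCB under local differential privacy, Gaussian mechanism).** *Problem.* There are $m$ base arms and a nonempty family $\mathcal S$ of super arms $S\subseteq[m]$ with $|S|\le K$. Outcome vectors $u_0,u_1,u_2,\dots\in[0,1]^m$ are i.i.d. with mean vector $u$ (different arms may be dependent). The expected reward $r_v(S)$, a function of $S\in\mathcal S$ and of a vector $v\in\mathbb R^m$, is nonnegative for $v\in[0,1]^m$, nondecreasing in $v$, and satisfies $B_\infty$ bounded smoothness: there is a function $f$, strictly increasing on $[0,\infty)$, with $|r_v(S)-r_{v'}(S)|\le f(\Lambda)$ whenever $\Lambda\ge 0$ and $|v_i-v'_i|\le\Lambda$ for all $i\in S$. Put $\mathrm{opt}_v=\max_{S\in\mathcal S}r_v(S)$. Let $\alpha,\beta\in(0,1]$ and let $\mathrm{Oracle}$ be a randomized $(\alpha,\beta)$-approximation oracle: for each $v\in\mathbb R^m$ with $\mathrm{opt}_v\ge 0$, $\Pr[r_v(\mathrm{Oracle}(v))\ge\alpha\,\mathrm{opt}_v]\ge\beta$. A super arm is bad if $r_u(S)<\alpha\,\mathrm{opt}_u$; $\Delta_{\min}$ and $\Delta_{\max}$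 are the least and the greatest value of $\alpha\,\mathrm{opt}_u-r_u(S)$ over the bad super arms, and $f^{-1}(\Delta_{\min})$ is assumed to exist and to be positive. (If there is no bad super arm, put $\Delta_{\max}=0$; the first bound below then reads $R(T)\le 0$.) *Algorithm.* Let $\epsilon>0$, $\delta\in(0,1)$, $\sigma=\frac1\epsilon\sqrt{2K\log\frac{1.25}{\delta}}$. Initially $T_i=1$ and $\hat u_i=u_0(i)$ for all $i\in[m]$; in rounds $t=1,\dots,m$ arbitrary fixed super arms $S_t\in\mathcal S$ are played without updates. In each round $t=m+1,m+2,\dots$ the algorithm sets $$\bar u_i=\hat u_i+\sqrt{\frac{3\log t}{2T_i}}+\frac2\epsilon\sqrt{\frac{2K\log\frac{1.25}{\delta}\log t}{T_i}}\qquad(i\in[m]),$$ plays $S_t=\mathrm{Oracle}(\bar u_1,\dots,\bar u_m)$, and for each $i\in S_t$ replaces $\hat u_i$ by $\frac{T_i\hat u_i+u_t(i)+Z_{t,i}}{T_i+1}$ and then $T_i$ by $T_i+1$, where the $Z_{t,i}\sim\mathcal N(0,\sigma^2)$ are independent. Outcomes, noise and the oracle's randomness in all rounds are independent. *Claim.*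 For every $T$, the regret $R(T)=T\alpha\beta\,\mathrm{opt}_u-\mathbb E\big[\sum_{t=1}^T r_u(S_t)\big]$ satisfies $$R(T)\le\left[\frac{128K\log\frac{1.25}{\delta}\log T}{\min\{\epsilon^2,2\}\,(f^{-1}(\Delta_{\min}))^2}+\frac{\pi^2}{3}+1\right]m\,\Delta_{\max}.$$ In particular $R(T)=\mathcal O\!\left(\frac{mK\log(1/\delta)\log T}{\epsilon^2}\right)$: for all $\epsilon_0>0$ and $\delta_0<1$ there is a constant $C$, depending only on $\epsilon_0,\delta_0,f^{-1}(\Delta_{\min}),\Delta_{\max}$, such that $R(T)\le C\,mK\log(1/\delta)\log T/\epsilon^2$ whenever $\epsilon\le\epsilon_0$, $\delta\le\delta_0$ and $T\ge2$. -/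

import Mathlib

open MeasureTheory ProbabilityTheory

noncomputable section

/-- A stochastic combinatorial semi-bandit with base arms `Fin m`. The outcome vectors of the
rounds are drawn from `law`, a distribution on `[0,1]^m` (different arms may be dependent).
`reward S v` is the expected reward `r_v(S)` of the super arm `S` when the vector of means is `v`;
it is a function on all of `ℝ^m` because upper confidence vectors, to which it is applied,
may leave the cube. -/
structure SemiBandit (m : ℕ) where
  /-- the feasible super arms -/
  superArms : Finset (Finset (Fin m))
  superArms_nonempty : superArms.Nonempty
  /-- distribution of the outcome vector of one round -/
  law : Measure (Fin m → ℝ)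
  law_prob : IsProbabilityMeasure law
  law_cube : ∀ᵐ x ∂law, ∀ i, x i ∈ Set.Icc (0 : ℝ) 1
  /-- expected reward of a super arm as a function of the vector of means -/
  reward : Finset (Fin m) → (Fin m → ℝ) → ℝ
  reward_nonneg : ∀ S ∈ superArms, ∀ v : Fin m → ℝ, (∀ i, v i ∈ Set.Icc (0 : ℝ) 1) →
    0 ≤ reward S v
  reward_mono : ∀ S ∈ superArms, Monotone (reward S)

attribute [instance] SemiBandit.law_prob

namespace SemiBandit

variable {m : ℕ} (B : SemiBandit m)

/-- The vector `u` of true means. -/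
def mean (i : Fin m) : ℝ := ∫ x, x i ∂B.law

/-- `opt_v`, the largest expected reward of a super arm under the vector `v`. -/
def opt (v : Fin m → ℝ) : ℝ := B.superArms.sup' B.superArms_nonempty fun S => B.reward S v

/-- Bounded smoothness of the reward with respect to the sup norm, with smoothness function `f`. -/
def BoundedSmooth (f : ℝ → ℝ) : Prop :=
  ∀ S ∈ B.superArms, ∀ v v' : Fin m → ℝ, ∀ d : ℝ, 0 ≤ d → (∀ i ∈ S, |v i - v' i| ≤ d) →
    |B.reward S v - B.reward S v'| ≤ f d

/-- The bad super arms: those with expected reward below `α · opt_u`. -/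
def bad (α : ℝ) : Set (Finset (Fin m)) :=
  {S | S ∈ B.superArms ∧ B.reward S B.mean < α * B.opt B.mean}

/-- The smallest gap `α · opt_u - r_u(S)` of a bad super arm. -/
def gapMin (α : ℝ) : ℝ := sInf ((fun S => α * B.opt B.mean - B.reward S B.mean) '' B.bad α)

/-- The largest gap of a bad super arm (`0` if there is no bad super arm). -/
def gapMax (α : ℝ) : ℝ := sSup ((fun S => α * B.opt B.mean - B.reward S B.mean) '' B.bad α)

/-- `O` is a randomized `(α, β)`-approximation oracle: on input `v` and a random seed drawn
from `ν` it returns a super arm that, with probability at least `β`, has reward at least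
`α · opt_v` under `v`. Only inputs with `opt_v ≥ 0` are subject to this, as no super arm need reach
`α · opt_v` when `opt_v < 0`. -/
structure IsOracle {Ξ : Type*} [MeasurableSpace Ξ] (ν : Measure Ξ) (α β : ℝ)
    (O : (Fin m → ℝ) → Ξ → Finset (Fin m)) : Prop where
  mem : ∀ v ξ, O v ξ ∈ B.superArms
  meas : ∀ S, MeasurableSet {p : (Fin m → ℝ) × Ξ | O p.1 p.2 = S}
  approx : ∀ v, 0 ≤ B.opt v →
    β ≤ ν.real {ξ | α * B.opt v ≤ B.reward (O v ξ) v}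

end SemiBandit

/-- The inverse of a smoothness function, defined on `[0, ∞)`. -/
def smoothInv (f : ℝ → ℝ) (y : ℝ) : ℝ := Function.invFunOn f (Set.Ici 0) y

/-! Combinatorial UCB with Gaussian noise added locally to every observation. -/
namespace CUCB

/-- Standard deviation of the noise. -/
def sigma (K : ℕ) (ε δ : ℝ) : ℝ := 1 / ε * √(2 * K * Real.log (1.25 / δ))

/-- The fresh randomness of one round: outcome vector, noise vector, seed of the oracle. -/
abbrev Sample (m : ℕ) (Ξ : Type*) := (Fin m → ℝ) × (Fin m → ℝ) × Ξ

/-- Law of the randomness of one round: the outcome vector, the independent `N(0, σ²)` noises of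
the arms and the seed are independent. -/
def sampleLaw {m : ℕ} (B : SemiBandit m) (K : ℕ) (ε δ : ℝ) {Ξ : Type*} [MeasurableSpace Ξ]
    (ν : Measure Ξ) : Measure (Sample m Ξ) :=
  B.law.prod ((Measure.pi fun _ : Fin m => gaussianReal 0 (sigma K ε δ ^ 2).toNNReal).prod ν)

/-- The memory of the algorithm: number of observations and noisy empirical mean of each arm. -/
structure State (m : ℕ) where
  count : Fin m → ℕ
  est : Fin m → ℝ

variable {m : ℕ} {Ξ : Type*}

/-- The upper confidence vector used in round `t`. -/
def ucb (K : ℕ) (ε δ : ℝ) (t : ℕ) (s : State m) (i : Fin m) : ℝ :=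
  s.est i + √(3 * Real.log t / (2 * s.count i))
    + 2 / ε * √(2 * K * Real.log (1.25 / δ) * Real.log t / s.count i)

/-- The super arm played in round `t ≥ 1` from the memory `s`: the rounds `1, …, m` are
initialization rounds with prescribed super arms `init t`; later the oracle is called. -/
def choose (K : ℕ) (ε δ : ℝ) (init : ℕ → Finset (Fin m)) (O : (Fin m → ℝ) → Ξ → Finset (Fin m))
    (x : ℕ → Sample m Ξ) (t : ℕ) (s : State m) : Finset (Fin m) :=
  if t ≤ m then init t else O (ucb K ε δ t s) (x t).2.2

/-- Update after playing `S`: each arm of `S` reports its outcome plus noise, which is averaged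
into its estimate. -/
def update (S : Finset (Fin m)) (y : Sample m Ξ) (s : State m) : State m where
  count i := if i ∈ S then s.count i + 1 else s.count i
  est i := if i ∈ S then (s.count i * s.est i + (y.1 i + y.2.1 i)) / (s.count i + 1) else s.est i

/-- Memory at the end of round `t` along the sample path `x`. At the start an outcome vector
`u₀ = (x 0).1` is observed; the updates begin with round `m + 1`. -/
def state (K : ℕ) (ε δ : ℝ) (init : ℕ → Finset (Fin m)) (O : (Fin m → ℝ) → Ξ → Finset (Fin m))
    (x : ℕ → Sample m Ξ) : ℕ → State m
  | 0 => ⟨fun _ => 1, (x 0).1⟩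
  | t + 1 =>
    let s := state K ε δ init O x t
    if t + 1 ≤ m then s else update (choose K ε δ init O x (t + 1) s) (x (t + 1)) s

/-- The super arm `S_t` played in round `t ≥ 1`. -/
def play (K : ℕ) (ε δ : ℝ) (init : ℕ → Finset (Fin m)) (O : (Fin m → ℝ) → Ξ → Finset (Fin m))
    (x : ℕ → Sample m Ξ) (t : ℕ) : Finset (Fin m) :=
  choose K ε δ init O x t (state K ε δ init O x (t - 1))

/-- The `(α, β)`-approximation regret `T α β opt_u - E[∑_{t=1}^T r_u(S_t)]`. -/
def regret (B : SemiBandit m) (α β : ℝ) (K : ℕ) (ε δ : ℝ) (init : ℕ → Finset (Fin m))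
    (O : (Fin m → ℝ) → Ξ → Finset (Fin m)) {Ω : Type*} [MeasurableSpace Ω] (μ : Measure Ω)
    (X : ℕ → Ω → Sample m Ξ) (T : ℕ) : ℝ :=
  T * α * β * B.opt B.mean
    - ∫ ω, ∑ t ∈ Finset.Icc 1 T, B.reward (play K ε δ init O (fun n => X n ω) t) B.mean ∂μ

end CUCB

end

/-! The regret is charged to two kinds of events per arm: a failed confidence bound, and a play of
an arm that has been observed only a few times.

Concentration. The number of observations of an arm depends on the past, so a Hoeffding bound for a
fixed number of samples does not apply directly. For each `l`, the exponential `expDev` of the noisy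
deviation is a supermartingale with initial expectation at most 1: Hoeffding's lemma handles the
outcome, the Gaussian moment generating function the noise (`lintegral_expDev_le_one`). Averaging
over a Gaussian `l` gives a closed form in the deviation and its variance proxy whose expectation is
still at most 1. Markov's inequality at one fixed round then covers all values of the count at once,
with failure probability at most `√3 / t ^ (3/2)` (`measureReal_dev_le`). These probabilities sum
over `t ≥ 2` to less than `π ^ 2 / 3`.

Regret. If all confidence bounds hold, the upper confidence vector dominates the mean. When the
oracle also meets its guarantee, monotonicity and smoothness force a bad super arm to contain an arm
whose upper confidence value exceeds its mean by at least `f⁻¹(Δ_min)` (`exists_loose_arm`). Such an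
arm has at most `b` observations, `b` being the logarithmic term of the bound (`count_le_of_loose`).
Playing it adds an observation, so this happens at most `b` times per arm (`sum_rare_le`). Hence
each round after the initialization loses in expectation at most `Δ_max` times its expected
`charge`. The total charge is at most `m (b + π ^ 2 / 3)`, and the `m` initialization rounds supply
the final `+ 1`. -/

/-! ### Analytic estimates: Gaussian mixture, a convergent series, a numerical logarithm bound. -/

/-- Mixing the exponential martingale over a centred Gaussian parameter of variance `1 / ρ`. -/
theorem lintegral_gaussian_mixture {ρ V : ℝ} (hρ : 0 < ρ) (hV : 0 ≤ V) (Z : ℝ) :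
    ∫⁻ l, ENNReal.ofReal (gaussianPDFReal 0 (1 / ρ).toNNReal l * Real.exp (l * Z - l ^ 2 * V / 2))
      = ENNReal.ofReal (√(ρ / (V + ρ)) * Real.exp (Z ^ 2 / (2 * (V + ρ)))) := by
  have hp : 0 < V + ρ := by positivity
  have hρ' : ((1 / ρ).toNNReal : ℝ) = 1 / ρ := Real.coe_toNNReal _ (by positivity)
  have hp' : ((1 / (V + ρ)).toNNReal : ℝ) = 1 / (V + ρ) := Real.coe_toNNReal _ (by positivity)
  -- Completing the square in `l` leaves a multiple of the Gaussian density with mean `Z / (V + ρ)`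
  -- and variance `1 / (V + ρ)`.
  have key : ∀ l, gaussianPDFReal 0 (1 / ρ).toNNReal l * Real.exp (l * Z - l ^ 2 * V / 2)
      = (√(ρ / (V + ρ)) * Real.exp (Z ^ 2 / (2 * (V + ρ))))
        * gaussianPDFReal (Z / (V + ρ)) (1 / (V + ρ)).toNNReal l := by
    intro l
    simp only [gaussianPDFReal, hρ', hp']
    have h1 : (√(2 * Real.pi * (1 / ρ)))⁻¹
        = √(ρ / (V + ρ)) * (√(2 * Real.pi * (1 / (V + ρ))))⁻¹ := by
      rw [← Real.sqrt_inv, ← Real.sqrt_inv, ← Real.sqrt_mul (by positivity)]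
      congr 1
      field_simp
    rw [h1, mul_assoc, mul_assoc, mul_mul_mul_comm, mul_assoc, mul_assoc, ← Real.exp_add]
    rw [← Real.exp_add]
    congr 3
    field_simp
    ring
  simp_rw [key]
  have hc : 0 ≤ √(ρ / (V + ρ)) * Real.exp (Z ^ 2 / (2 * (V + ρ))) := by positivity
  simp_rw [ENNReal.ofReal_mul hc]
  rw [lintegral_const_mul _ (by fun_prop)]
  have hne : (1 / (V + ρ)).toNNReal ≠ 0 := by
    simpa using hp
  have := lintegral_gaussianPDFReal_eq_one (Z / (V + ρ)) hne
  rw [this, mul_one]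

/-- The midpoint bound for the convex function `x ^ (-3/2)` on `[t - 1/2, t + 1/2]`, in a form that
telescopes. Algebraically it reduces to `ab ≤ t` and `a + b ≤ 2√t` for the two square roots `a`,
`b`. -/
theorem inv_mul_sqrt_le_sub {t : ℝ} (ht : 1 ≤ t) :
    1 / (t * √t) ≤ 2 / √(t - 1 / 2) - 2 / √(t + 1 / 2) := by
  have ha : 0 < t - 1 / 2 := by linarith
  have hb : 0 < t + 1 / 2 := by linarith
  have hA := Real.sqrt_pos.2 ha
  have hB := Real.sqrt_pos.2 hb
  have hT := Real.sqrt_pos.2 (by linarith : 0 < t)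
  have eA := Real.sq_sqrt ha.le
  have eB := Real.sq_sqrt hb.le
  have eT := Real.sq_sqrt (by linarith : 0 ≤ t)
  set a := √(t - 1 / 2)
  set b := √(t + 1 / 2)
  set c := √t
  have h1 : a * b ≤ t := by nlinarith [sq_nonneg (a - b)]
  have h2 : a + b ≤ 2 * c := by
    apply (sq_le_sq₀ (by positivity) (by positivity)).1
    nlinarith [sq_nonneg (a - b)]
  have h3 : 2 / a - 2 / b = 2 / (a * b * (a + b)) := by
    rw [div_sub_div _ _ hA.ne' hB.ne', div_eq_div_iff (by positivity) (by positivity)]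
    linear_combination 2 * a * b * (eB - eA)
  rw [h3, div_le_div_iff₀ (by positivity) (by positivity)]
  have := mul_le_mul h1 h2 (by positivity) (by linarith)
  linarith

/-- The failure probabilities are summed only after the initialization. Since `1 ≤ m`, the term of
round 1 is absent, and telescoping from `3/2` gives `2√2 ≤ 3 ≤ π ^ 2 / 3`. -/
theorem sum_sqrt_three_div_le (m T : ℕ) (hm : 1 ≤ m) :
    ∑ n ∈ Finset.range T, (if n + 1 ≤ m then 0 else √3 / (((n + 1 : ℕ) : ℝ) * √((n + 1 : ℕ) : ℝ)))
      ≤ Real.pi ^ 2 / 3 := by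
  have key : ∀ T : ℕ, ∑ n ∈ Finset.range (T + 1),
      (if n + 1 ≤ m then 0 else √3 / (((n + 1 : ℕ) : ℝ) * √((n + 1 : ℕ) : ℝ)))
        ≤ √3 * (2 / √(3 / 2) - 2 / √((T : ℝ) + 3 / 2)) := by
    intro T
    induction T with
    | zero => simp [Nat.lt_of_succ_le hm]
    | succ T ih =>
      rw [Finset.sum_range_succ]
      have h := inv_mul_sqrt_le_sub (t := ((T + 1 + 1 : ℕ) : ℝ)) (by push_cast; linarith [T.cast_nonneg (α := ℝ)])
      have e1 : ((T + 1 + 1 : ℕ) : ℝ) - 1 / 2 = T + 3 / 2 := by push_cast; ring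
      have e2 : ((T + 1 + 1 : ℕ) : ℝ) + 1 / 2 = (T + 1 : ℕ) + 3 / 2 := by push_cast; ring
      rw [e1, e2] at h
      have h' := mul_le_mul_of_nonneg_left h (Real.sqrt_nonneg 3)
      rw [mul_one_div] at h'
      have h0 : (if T + 1 + 1 ≤ m then 0 else √3 / (((T + 1 + 1 : ℕ) : ℝ) * √((T + 1 + 1 : ℕ) : ℝ)))
          ≤ √3 / (((T + 1 + 1 : ℕ) : ℝ) * √((T + 1 + 1 : ℕ) : ℝ)) := by
        split_ifs
        · positivity
        · exact le_rfl
      linarith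
  have h3 : √3 * (2 / √(3 / 2)) ≤ 3 := by
    have : √3 = √2 * √(3 / 2) := by
      rw [← Real.sqrt_mul (by norm_num)]; norm_num
    rw [this]
    have h0 : √(3 / 2 : ℝ) ≠ 0 := (Real.sqrt_pos.2 (by norm_num)).ne'
    have : √2 * √(3 / 2 : ℝ) * (2 / √(3 / 2)) = 2 * √2 := by field_simp
    rw [this]
    have : √2 ≤ 3 / 2 := by
      rw [Real.sqrt_le_left (by norm_num)]; norm_num
    linarith
  have hpi : (3 : ℝ) ≤ Real.pi ^ 2 / 3 := by nlinarith [Real.pi_gt_three]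
  rcases T with _ | T
  · simp; positivity
  · have := key T
    have h4 : 0 ≤ √3 * (2 / √((T : ℝ) + 3 / 2)) := by positivity
    linarith

theorem log_five_quarters_ge : (0.223 : ℝ) ≤ Real.log 1.25 := by
  rw [Real.le_log_iff_exp_le (by norm_num)]
  have := Real.exp_bound' (x := 0.223) (by norm_num) (by norm_num) (n := 4) (by norm_num)
  refine this.trans ?_
  norm_num [Finset.sum_range_succ, Nat.factorial]

theorem sum_Icc_one_eq_sum_range {M : Type*} [AddCommMonoid M] (g : ℕ → M) (T : ℕ) :
    ∑ t ∈ Finset.Icc 1 T, g t = ∑ n ∈ Finset.range T, g (n + 1) := by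
  induction T with
  | zero => simp
  | succ T ih => rw [Finset.sum_Icc_succ_top (by omega), ih, Finset.sum_range_succ]

/-! ### The algorithm as a Markov recursion: measurability and independence of the fresh randomness.
-/

namespace CUCB

variable {m : ℕ} {Ξ : Type*}

instance : MeasurableSpace (State m) :=
  MeasurableSpace.comap (fun s => (s.count, s.est)) inferInstance

theorem measurable_count : Measurable (State.count : State m → Fin m → ℕ) :=
  measurable_fst.comp (comap_measurable fun s : State m => (s.count, s.est))

theorem measurable_est : Measurable (State.est : State m → Fin m → ℝ) :=
  measurable_snd.comp (comap_measurable fun s : State m => (s.count, s.est))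

theorem measurable_count_apply (i : Fin m) : Measurable fun s : State m => s.count i :=
  (measurable_pi_apply i).comp measurable_count

theorem measurable_est_apply (i : Fin m) : Measurable fun s : State m => s.est i :=
  (measurable_pi_apply i).comp measurable_est

theorem measurable_state_mk {A : Type*} [MeasurableSpace A] {g : A → State m}
    (hc : ∀ i, Measurable fun a => (g a).count i) (he : ∀ i, Measurable fun a => (g a).est i) :
    Measurable g :=
  measurable_comap_iff.2 ((measurable_pi_iff.2 hc).prodMk (measurable_pi_iff.2 he))

theorem measurable_ucb (K : ℕ) (ε δ : ℝ) (t : ℕ) :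
    Measurable (ucb K ε δ t : State m → Fin m → ℝ) := by
  refine measurable_pi_iff.2 fun i => ?_
  have hc : Measurable fun s : State m => (s.count i : ℝ) :=
    measurable_from_top.comp (measurable_count_apply i)
  have he := measurable_est_apply (m := m) i
  unfold ucb
  fun_prop

/-- The super arm played in round `t`, as a function of the memory and of the seed. -/
noncomputable def pick (K : ℕ) (ε δ : ℝ) (init : ℕ → Finset (Fin m)) (O : (Fin m → ℝ) → Ξ → Finset (Fin m))
    (t : ℕ) (s : State m) (ξ : Ξ) : Finset (Fin m) :=
  if t ≤ m then init t else O (ucb K ε δ t s) ξ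

/-- One round of the algorithm, as a function of the memory and of the fresh randomness. -/
noncomputable def step (K : ℕ) (ε δ : ℝ) (init : ℕ → Finset (Fin m)) (O : (Fin m → ℝ) → Ξ → Finset (Fin m))
    (t : ℕ) (s : State m) (y : Sample m Ξ) : State m :=
  if t ≤ m then s else update (pick K ε δ init O t s y.2.2) y s

variable {K : ℕ} {ε δ : ℝ} {init : ℕ → Finset (Fin m)} {O : (Fin m → ℝ) → Ξ → Finset (Fin m)}

theorem state_succ (x : ℕ → Sample m Ξ) (t : ℕ) :
    state K ε δ init O x (t + 1)
      = step K ε δ init O (t + 1) (state K ε δ init O x t) (x (t + 1)) := rfl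

theorem play_succ (x : ℕ → Sample m Ξ) (t : ℕ) :
    play K ε δ init O x (t + 1)
      = pick K ε δ init O (t + 1) (state K ε δ init O x t) (x (t + 1)).2.2 := rfl

theorem state_congr {x y : ℕ → Sample m Ξ} (t : ℕ) (h : ∀ j ≤ t, x j = y j) :
    state K ε δ init O x t = state K ε δ init O y t := by
  induction t with
  | zero => simp [state, h 0]
  | succ t ih => rw [state_succ, state_succ, ih fun j hj => h j (by omega), h (t + 1) le_rfl]

/-- The lower bound keeps the divisions by the count and the variance proxy meaningful; the upper
bound controls the prefactor of the Gaussian mixture. -/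
theorem count_state_bounds (x : ℕ → Sample m Ξ) (i : Fin m) (t : ℕ) :
    1 ≤ (state K ε δ init O x t).count i ∧ (state K ε δ init O x t).count i ≤ t + 1 := by
  induction t with
  | zero => simp [state]
  | succ t ih =>
    rw [state_succ, step]
    split_ifs with h
    · omega
    · simp only [update]
      split_ifs <;> omega

variable [MeasurableSpace Ξ]

/-- A condition on the answer of the oracle is an event. -/
theorem measurableSet_oracle {O : (Fin m → ℝ) → Ξ → Finset (Fin m)}
    (hO : ∀ S, MeasurableSet {p : (Fin m → ℝ) × Ξ | O p.1 p.2 = S})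
    (P : Finset (Fin m) → Prop) : MeasurableSet {p : (Fin m → ℝ) × Ξ | P (O p.1 p.2)} := by
  have : {p : (Fin m → ℝ) × Ξ | P (O p.1 p.2)}
      = ⋃ S ∈ {S | P S}, {p : (Fin m → ℝ) × Ξ | O p.1 p.2 = S} := by
    ext p; simp
  rw [this]
  exact MeasurableSet.biUnion (Set.to_countable _) fun S _ => hO S

theorem measurableSet_pick (hO : ∀ S, MeasurableSet {p : (Fin m → ℝ) × Ξ | O p.1 p.2 = S})
    (t : ℕ) (P : Finset (Fin m) → Prop) :
    MeasurableSet {p : State m × Ξ | P (pick K ε δ init O t p.1 p.2)} := by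
  unfold pick
  split_ifs
  · exact MeasurableSet.const _
  · exact (((measurable_ucb K ε δ t).comp measurable_fst).prodMk measurable_snd)
      (measurableSet_oracle hO P)

theorem measurable_step (hO : ∀ S, MeasurableSet {p : (Fin m → ℝ) × Ξ | O p.1 p.2 = S}) (t : ℕ) :
    Measurable fun p : State m × Sample m Ξ => step K ε δ init O t p.1 p.2 := by
  unfold step
  split_ifs
  · exact measurable_fst
  have hS : ∀ i, MeasurableSet
      {p : State m × Sample m Ξ | i ∈ pick K ε δ init O t p.1 p.2.2.2} := fun i =>
    (measurable_fst.prodMk (measurable_snd.comp (measurable_snd.comp measurable_snd)))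
      (measurableSet_pick hO t fun S => i ∈ S)
  have hc : ∀ i, Measurable fun p : State m × Sample m Ξ => p.1.count i := fun i =>
    (measurable_count_apply i).comp measurable_fst
  have hc' : ∀ i, Measurable fun p : State m × Sample m Ξ => (p.1.count i : ℝ) := fun i =>
    measurable_from_top.comp (hc i)
  have he : ∀ i, Measurable fun p : State m × Sample m Ξ => p.1.est i := fun i =>
    (measurable_est_apply i).comp measurable_fst
  refine measurable_state_mk (fun i => ?_) fun i => ?_
  · exact Measurable.ite (hS i) ((hc i).add_const 1) (hc i)
  · refine Measurable.ite (hS i) ?_ (he i)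
    have := hc' i
    have := he i
    fun_prop

theorem measurable_state (hO : ∀ S, MeasurableSet {p : (Fin m → ℝ) × Ξ | O p.1 p.2 = S}) (t : ℕ) :
    Measurable fun x : ℕ → Sample m Ξ => state K ε δ init O x t := by
  induction t with
  | zero =>
    refine measurable_state_mk (fun i => measurable_const) fun i => ?_
    simp only [state]
    fun_prop
  | succ t ih =>
    simp only [state_succ]
    exact (measurable_step hO (t + 1)).comp (ih.prodMk (measurable_pi_apply _))

section Independence

variable {Ω : Type*} [MeasurableSpace Ω] {μ : Measure Ω}
  {X : ℕ → Ω → Sample m Ξ}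

theorem measurable_state_path (hO : ∀ S, MeasurableSet {p : (Fin m → ℝ) × Ξ | O p.1 p.2 = S})
    (hX : ∀ t, Measurable (X t)) (t : ℕ) :
    Measurable fun ω => state K ε δ init O (fun n => X n ω) t :=
  (measurable_state hO t).comp (measurable_pi_iff.2 hX)

/-- The memory after round `t` is independent of the randomness of round `t + 1`. -/
theorem indepFun_state (hO : ∀ S, MeasurableSet {p : (Fin m → ℝ) × Ξ | O p.1 p.2 = S})
    (hX : ∀ t, Measurable (X t)) (hind : iIndepFun X μ) (t : ℕ) :
    IndepFun (fun ω => state K ε δ init O (fun n => X n ω) t) (X (t + 1)) μ := by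
  have h := hind.indepFun_finset (Finset.range (t + 1)) {t + 1} (by simp) hX
  have hlt : ∀ n, min n t ∈ Finset.range (t + 1) := fun n => by simp
  -- The memory reads only samples `0, …, t`; freezing the index at `t` turns a finite tuple into a
  -- full path without changing it.
  let φ : (Finset.range (t + 1) → Sample m Ξ) → State m := fun z =>
    state K ε δ init O (fun n => z ⟨min n t, hlt n⟩) t
  have hφ : Measurable φ :=
    (measurable_state hO t).comp (measurable_pi_iff.2 fun n => measurable_pi_apply _)
  let ψ : (({t + 1} : Finset ℕ) → Sample m Ξ) → Sample m Ξ := fun z => z ⟨t + 1, by simp⟩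
  have hψ : Measurable ψ := measurable_pi_apply _
  have h' := h.comp hφ hψ
  have e : (φ ∘ fun ω (i : Finset.range (t + 1)) => X i ω)
      = fun ω => state K ε δ init O (fun n => X n ω) t := by
    funext ω
    exact state_congr t fun j hj => by simp [hj]
  rw [e] at h'
  exact h'

variable [IsProbabilityMeasure μ] {B : SemiBandit m} {ν : Measure Ξ}

instance [IsProbabilityMeasure ν] : IsProbabilityMeasure (sampleLaw B K ε δ ν) := by
  unfold sampleLaw; infer_instance

theorem map_state_prod (hO : ∀ S, MeasurableSet {p : (Fin m → ℝ) × Ξ | O p.1 p.2 = S})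
    (hX : ∀ t, Measurable (X t)) (hind : iIndepFun X μ)
    (hlaw : ∀ t, μ.map (X t) = sampleLaw B K ε δ ν) (t : ℕ) :
    μ.map (fun ω => (state K ε δ init O (fun n => X n ω) t, X (t + 1) ω))
      = (μ.map fun ω => state K ε δ init O (fun n => X n ω) t).prod (sampleLaw B K ε δ ν) := by
  rw [(indepFun_state hO hX hind t).map_prod_eq_prod_map_map
    (measurable_state_path hO hX t).aemeasurable (hX _).aemeasurable, hlaw]

/-- The choice in a round uses only the memory and the seed, so this marginal of the joint law
suffices for the reward analysis. -/
theorem map_state_seed [IsProbabilityMeasure ν]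
    (hO : ∀ S, MeasurableSet {p : (Fin m → ℝ) × Ξ | O p.1 p.2 = S})
    (hX : ∀ t, Measurable (X t)) (hind : iIndepFun X μ)
    (hlaw : ∀ t, μ.map (X t) = sampleLaw B K ε δ ν) (t : ℕ) :
    μ.map (fun ω => (state K ε δ init O (fun n => X n ω) t, (X (t + 1) ω).2.2))
      = (μ.map fun ω => state K ε δ init O (fun n => X n ω) t).prod ν := by
  have hs : Measurable fun y : Sample m Ξ => y.2.2 := measurable_snd.comp measurable_snd
  have h := (indepFun_state (K := K) (ε := ε) (δ := δ) (init := init) hO hX hind t).comp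
    measurable_id hs
  have h2 := h.map_prod_eq_prod_map_map
    (measurable_state_path hO hX t).aemeasurable (hs.comp (hX _)).aemeasurable
  have h3 : μ.map ((fun y : Sample m Ξ => y.2.2) ∘ X (t + 1)) = ν := by
    rw [← Measure.map_map hs (hX _), hlaw, sampleLaw,
      ← Function.comp_def Prod.snd Prod.snd, ← Measure.map_map measurable_snd measurable_snd,
      Measure.map_snd_prod, measure_univ, one_smul, Measure.map_snd_prod, measure_univ, one_smul]
  rw [h3] at h2
  exact h2

end Independence

end CUCB

/-! ### Concentration of the noisy estimates by the method of mixtures. -/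

namespace CUCB

variable {m : ℕ} {Ξ : Type*}

/-- The deviation of the sum of the noisy observations of arm `i` from its mean. -/
noncomputable def dev (B : SemiBandit m) (i : Fin m) (s : State m) : ℝ :=
  s.count i * (s.est i - B.mean i)

/-- The variance proxy of `dev`: the first observation carries no noise. -/
noncomputable def proxy (σ : ℝ) (i : Fin m) (s : State m) : ℝ :=
  s.count i / 4 + σ ^ 2 * (s.count i - 1)

/-- The exponential supermartingale of arm `i` with parameter `l`. -/
noncomputable def expDev (B : SemiBandit m) (σ : ℝ) (i : Fin m) (l : ℝ) (s : State m) : ℝ :=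
  Real.exp (l * dev B i s - l ^ 2 * proxy σ i s / 2)

theorem measurable_dev (B : SemiBandit m) (i : Fin m) : Measurable (dev B i) := by
  have hc : Measurable fun s : State m => (s.count i : ℝ) :=
    measurable_from_top.comp (measurable_count_apply i)
  have he := measurable_est_apply (m := m) i
  unfold dev
  fun_prop

theorem measurable_proxy (σ : ℝ) (i : Fin m) : Measurable (proxy σ i : State m → ℝ) := by
  have hc : Measurable fun s : State m => (s.count i : ℝ) :=
    measurable_from_top.comp (measurable_count_apply i)
  unfold proxy
  fun_prop

theorem measurable_expDev (B : SemiBandit m) (σ : ℝ) (i : Fin m) :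
    Measurable fun p : ℝ × State m => expDev B σ i p.1 p.2 := by
  have h1 : Measurable fun p : ℝ × State m => dev B i p.2 :=
    (measurable_dev B i).comp measurable_snd
  have h2 : Measurable fun p : ℝ × State m => proxy σ i p.2 :=
    (measurable_proxy σ i).comp measurable_snd
  unfold expDev
  fun_prop

/-- Hoeffding's lemma for the outcome of arm `i`. -/
theorem lintegral_exp_outcome_le (B : SemiBandit m) (i : Fin m) (l : ℝ) :
    ∫⁻ x, ENNReal.ofReal (Real.exp (l * (x i - B.mean i) - l ^ 2 / 8)) ∂B.law ≤ 1 := by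
  have hsub := hasSubgaussianMGF_of_mem_Icc (μ := B.law) (X := fun x : Fin m → ℝ => x i)
    (measurable_pi_apply i).aemeasurable (a := 0) (b := 1)
    (by filter_upwards [B.law_cube] with x hx using hx i)
  have hint := hsub.integrable_exp_mul l
  have hle := hsub.mgf_le l
  have hfun : ∀ x : Fin m → ℝ, Real.exp (l * (x i - B.mean i) - l ^ 2 / 8)
      = Real.exp (l * (x i - ∫ y, y i ∂B.law)) * Real.exp (-(l ^ 2 / 8)) := fun x => by
    rw [← Real.exp_add]; rfl
  simp_rw [hfun]
  rw [← ofReal_integral_eq_lintegral_ofReal (hint.mul_const _)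
    (Filter.Eventually.of_forall fun x => by positivity), integral_mul_const,
    ENNReal.ofReal_le_one]
  refine (mul_le_mul_of_nonneg_right hle (Real.exp_pos _).le).trans ?_
  rw [← Real.exp_add, Real.exp_le_one_iff]
  simp
  linarith

/-- The exponential moment of the noise of arm `i`. -/
theorem lintegral_exp_noise_le (σ : ℝ) (i : Fin m) (l : ℝ) :
    ∫⁻ z, ENNReal.ofReal (Real.exp (l * z i - l ^ 2 * σ ^ 2 / 2))
      ∂(Measure.pi fun _ : Fin m => gaussianReal 0 (σ ^ 2).toNNReal) ≤ 1 := by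
  have hmp := measurePreserving_eval (fun _ : Fin m => gaussianReal 0 (σ ^ 2).toNNReal) i
  have hm : Measurable fun z : ℝ => ENNReal.ofReal (Real.exp (l * z - l ^ 2 * σ ^ 2 / 2)) := by
    fun_prop
  have e := hmp.lintegral_comp hm
  simp only [Function.eval] at e
  rw [e]
  have hfun : ∀ z : ℝ, Real.exp (l * z - l ^ 2 * σ ^ 2 / 2)
      = Real.exp (l * z) * Real.exp (-(l ^ 2 * σ ^ 2 / 2)) := fun z => by
    rw [← Real.exp_add]; rfl
  simp_rw [hfun]
  rw [← ofReal_integral_eq_lintegral_ofReal ((integrable_exp_mul_gaussianReal l).mul_const _)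
    (Filter.Eventually.of_forall fun x => by positivity), integral_mul_const,
    ENNReal.ofReal_le_one]
  have hmgf := congrFun (mgf_id_gaussianReal (μ := 0) (v := (σ ^ 2).toNNReal)) l
  simp only [mgf, id] at hmgf
  rw [hmgf, ← Real.exp_add, Real.exp_le_one_iff, Real.coe_toNNReal _ (sq_nonneg σ)]
  linarith

variable {K : ℕ} {ε δ : ℝ} {init : ℕ → Finset (Fin m)} {O : (Fin m → ℝ) → Ξ → Finset (Fin m)}

/-- An observation adds `(outcome - mean) + noise` to `dev` and `1/4 + σ ^ 2` to `proxy`, so the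
exponential gains one factor for the outcome and one for the noise. -/
theorem expDev_step (B : SemiBandit m) (σ : ℝ) (i : Fin m) (l : ℝ) {t : ℕ} (ht : ¬ t ≤ m)
    (s : State m) (y : Sample m Ξ) :
    ENNReal.ofReal (expDev B σ i l (step K ε δ init O t s y)) = ENNReal.ofReal (expDev B σ i l s)
      * if i ∈ pick K ε δ init O t s y.2.2 then
          ENNReal.ofReal (Real.exp (l * (y.1 i - B.mean i) - l ^ 2 / 8))
            * ENNReal.ofReal (Real.exp (l * y.2.1 i - l ^ 2 * σ ^ 2 / 2))
        else 1 := by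
  rw [step, if_neg ht]
  simp only [expDev, dev, proxy, update]
  split_ifs with hi
  · rw [← ENNReal.ofReal_mul (Real.exp_pos _).le, ← ENNReal.ofReal_mul (Real.exp_pos _).le,
      ← Real.exp_add, ← Real.exp_add]
    congr 2
    have : (s.count i : ℝ) + 1 ≠ 0 := by positivity
    push_cast
    field_simp
    ring
  · rw [mul_one]

variable [MeasurableSpace Ξ] {ν : Measure Ξ} [IsProbabilityMeasure ν]

/-- The supermartingale property. Given the memory, whether arm `i` is observed depends on the seed
alone, which is independent of the outcome and the noise. -/
theorem lintegral_expDev_step_le (hO : ∀ S, MeasurableSet {p : (Fin m → ℝ) × Ξ | O p.1 p.2 = S})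
    (B : SemiBandit m) (i : Fin m) (l : ℝ) (t : ℕ) (s : State m) :
    ∫⁻ y, ENNReal.ofReal (expDev B (sigma K ε δ) i l (step K ε δ init O t s y))
      ∂(sampleLaw B K ε δ ν) ≤ ENNReal.ofReal (expDev B (sigma K ε δ) i l s) := by
  by_cases ht : t ≤ m
  · simp [step, ht]
  set σ := sigma K ε δ
  simp_rw [expDev_step B σ i l ht s]
  have hS : MeasurableSet {ξ | i ∈ pick K ε δ init O t s ξ} :=
    measurable_prodMk_left (measurableSet_pick hO t fun S => i ∈ S)
  have hx : Measurable fun x : Fin m → ℝ =>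
      ENNReal.ofReal (Real.exp (l * (x i - B.mean i) - l ^ 2 / 8)) := by fun_prop
  have hz : Measurable fun z : Fin m → ℝ =>
      ENNReal.ofReal (Real.exp (l * z i - l ^ 2 * σ ^ 2 / 2)) := by fun_prop
  have hmeas : Measurable fun y : Sample m Ξ =>
      if i ∈ pick K ε δ init O t s y.2.2 then
        ENNReal.ofReal (Real.exp (l * (y.1 i - B.mean i) - l ^ 2 / 8))
          * ENNReal.ofReal (Real.exp (l * y.2.1 i - l ^ 2 * σ ^ 2 / 2))
      else 1 :=
    Measurable.ite ((measurable_snd.comp measurable_snd) hS)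
      ((hx.comp measurable_fst).mul (hz.comp (measurable_fst.comp measurable_snd)))
      measurable_const
  rw [lintegral_const_mul _ hmeas]
  refine mul_le_of_le_one_right' ?_
  -- The seed becomes the outermost variable, so that the selection is fixed while outcome and noise
  -- are integrated.
  rw [sampleLaw, lintegral_prod_symm _ hmeas.aemeasurable, lintegral_prod_symm]
  · refine (lintegral_mono (g := fun _ => 1) fun ξ => ?_).trans (by simp)
    dsimp only
    split_ifs
    · have h1 : ∀ z : Fin m → ℝ, ∫⁻ x,
          ENNReal.ofReal (Real.exp (l * (x i - B.mean i) - l ^ 2 / 8))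
            * ENNReal.ofReal (Real.exp (l * z i - l ^ 2 * σ ^ 2 / 2)) ∂B.law
          ≤ ENNReal.ofReal (Real.exp (l * z i - l ^ 2 * σ ^ 2 / 2)) := fun z => by
        rw [lintegral_mul_const _ hx]
        exact mul_le_of_le_one_left' (lintegral_exp_outcome_le B i l)
      exact (lintegral_mono h1).trans (lintegral_exp_noise_le σ i l)
    · simp
  · exact (Measurable.lintegral_prod_left' hmeas).aemeasurable

section Path

variable {Ω : Type*} [MeasurableSpace Ω] {μ : Measure Ω} [IsProbabilityMeasure μ]
  {X : ℕ → Ω → Sample m Ξ} {B : SemiBandit m}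

theorem lintegral_expDev_le_one
    (hO : ∀ S, MeasurableSet {p : (Fin m → ℝ) × Ξ | O p.1 p.2 = S})
    (hX : ∀ t, Measurable (X t)) (hind : iIndepFun X μ)
    (hlaw : ∀ t, μ.map (X t) = sampleLaw B K ε δ ν) (i : Fin m) (l : ℝ) (t : ℕ) :
    ∫⁻ ω, ENNReal.ofReal (expDev B (sigma K ε δ) i l (state K ε δ init O (fun n => X n ω) t)) ∂μ
      ≤ 1 := by
  have hM : Measurable fun s : State m => ENNReal.ofReal (expDev B (sigma K ε δ) i l s) :=
    ((measurable_expDev B _ i).comp measurable_prodMk_left).ennreal_ofReal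
  induction t with
  | zero =>
    have hx : Measurable fun x : Fin m → ℝ =>
      ENNReal.ofReal (Real.exp (l * (x i - B.mean i) - l ^ 2 / 8)) := by fun_prop
    have e : ∀ ω, ENNReal.ofReal
        (expDev B (sigma K ε δ) i l (state K ε δ init O (fun n => X n ω) 0))
        = (fun y : Sample m Ξ =>
          ENNReal.ofReal (Real.exp (l * (y.1 i - B.mean i) - l ^ 2 / 8))) (X 0 ω) := fun ω => by
      simp only [expDev, dev, proxy, state]
      congr 2
      push_cast
      ring
    simp_rw [e]
    have hx' : Measurable fun y : Sample m Ξ =>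
      ENNReal.ofReal (Real.exp (l * (y.1 i - B.mean i) - l ^ 2 / 8)) := hx.comp measurable_fst
    rw [← lintegral_map (f := fun y : Sample m Ξ =>
          ENNReal.ofReal (Real.exp (l * (y.1 i - B.mean i) - l ^ 2 / 8)))
      hx' (hX 0), hlaw 0, sampleLaw, lintegral_prod _ hx'.aemeasurable]
    simpa using lintegral_exp_outcome_le B i l
  | succ t ih =>
    refine le_trans ?_ ih
    have hst := measurable_state_path (K := K) (ε := ε) (δ := δ) (init := init) hO hX t
    have hF : Measurable fun p : State m × Sample m Ξ =>
        ENNReal.ofReal (expDev B (sigma K ε δ) i l (step K ε δ init O (t + 1) p.1 p.2)) :=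
      hM.comp (measurable_step hO (t + 1))
    simp_rw [state_succ]
    rw [← lintegral_map (f := fun p : State m × Sample m Ξ =>
        ENNReal.ofReal (expDev B (sigma K ε δ) i l (step K ε δ init O (t + 1) p.1 p.2)))
      hF (hst.prodMk (hX (t + 1))), map_state_prod hO hX hind hlaw t,
      lintegral_prod _ hF.aemeasurable, ← lintegral_map hM hst]
    exact lintegral_mono fun s => lintegral_expDev_step_le hO B i l (t + 1) s

/-- The mixture of the exponential supermartingales over a Gaussian parameter. -/
theorem lintegral_mixture_le_one
    (hO : ∀ S, MeasurableSet {p : (Fin m → ℝ) × Ξ | O p.1 p.2 = S})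
    (hX : ∀ t, Measurable (X t)) (hind : iIndepFun X μ)
    (hlaw : ∀ t, μ.map (X t) = sampleLaw B K ε δ ν) (i : Fin m) {ρ : ℝ} (hρ : 0 < ρ) (t : ℕ) :
    ∫⁻ ω, ENNReal.ofReal
      (√(ρ / (proxy (sigma K ε δ) i (state K ε δ init O (fun n => X n ω) t) + ρ))
        * Real.exp (dev B i (state K ε δ init O (fun n => X n ω) t) ^ 2
          / (2 * (proxy (sigma K ε δ) i (state K ε δ init O (fun n => X n ω) t) + ρ)))) ∂μ
      ≤ 1 := by
  have hst := measurable_state_path (K := K) (ε := ε) (δ := δ) (init := init) hO hX t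
  have hV : ∀ ω, 0 ≤ proxy (sigma K ε δ) i (state K ε δ init O (fun n => X n ω) t) := fun ω => by
    have h1 : (1 : ℝ) ≤ (state K ε δ init O (fun n => X n ω) t).count i :=
      mod_cast (count_state_bounds (fun n => X n ω) i t).1
    have := mul_nonneg (sq_nonneg (sigma K ε δ)) (sub_nonneg.2 h1)
    unfold proxy
    positivity
  simp_rw [← lintegral_gaussian_mixture hρ (hV _)]
  -- By Tonelli, each fixed `l` contributes at most its density, and the density integrates to 1.
  rw [lintegral_lintegral_swap]
  · have hne : (1 / ρ).toNNReal ≠ 0 := by simpa using hρ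
    rw [← lintegral_gaussianPDFReal_eq_one 0 hne]
    refine lintegral_mono fun l => ?_
    simp_rw [ENNReal.ofReal_mul (gaussianPDFReal_nonneg _ _ l)]
    rw [lintegral_const_mul']
    · exact mul_le_of_le_one_right' (lintegral_expDev_le_one hO hX hind hlaw i l t)
    · exact ENNReal.ofReal_ne_top
  · refine Measurable.aemeasurable ?_
    refine Measurable.ennreal_ofReal ?_
    have h1 : Measurable fun p : Ω × ℝ => gaussianPDFReal 0 (1 / ρ).toNNReal p.2 :=
      (measurable_gaussianPDFReal _ _).comp measurable_snd
    have h2 : Measurable fun p : Ω × ℝ =>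
        expDev B (sigma K ε δ) i p.2 (state K ε δ init O (fun n => X n p.1) t) :=
      (measurable_expDev B _ i).comp (measurable_snd.prodMk (hst.comp measurable_fst))
    exact h1.mul h2

/-- The time-uniform confidence bound of an arm fails in round `t + 1` with small probability. -/
theorem measureReal_dev_le
    (hO : ∀ S, MeasurableSet {p : (Fin m → ℝ) × Ξ | O p.1 p.2 = S})
    (hX : ∀ t, Measurable (X t)) (hind : iIndepFun X μ)
    (hlaw : ∀ t, μ.map (X t) = sampleLaw B K ε δ ν) (i : Fin m) (t : ℕ) :
    μ.real {ω | (4 * sigma K ε δ ^ 2 + 3 / 2)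
        * (state K ε δ init O (fun n => X n ω) t).count i * Real.log (t + 1 : ℕ)
        < dev B i (state K ε δ init O (fun n => X n ω) t) ^ 2}
      ≤ √3 / (((t + 1 : ℕ) : ℝ) * √((t + 1 : ℕ) : ℝ)) := by
  set σ := sigma K ε δ
  set r : ℝ := ((t + 1 : ℕ) : ℝ) with hr
  have hr1 : 1 ≤ r := by rw [hr]; exact_mod_cast Nat.le_add_left 1 t
  have hlog : 0 ≤ Real.log r := Real.log_nonneg hr1
  -- With this `ρ` the missing noise of the first observation is restored: `proxy + ρ = k (σ ^ 2 +
  -- 1/4) + 1/8`, where `k` is the count.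
  set ρ : ℝ := σ ^ 2 + 1 / 8 with hρdef
  have hρ : 0 < ρ := by positivity
  have hmix := lintegral_mixture_le_one (init := init) hO hX hind hlaw i hρ t
  -- The Markov level is `r ^ 2 / √(3 r)`: the exponential is at least `r ^ 2` on the failure event,
  -- and the square-root prefactor at least `1 / √(3 r)`.
  set c : ℝ := r * √r / √3 with hc
  have hc0 : 0 < c := by positivity
  have hmarkov := (mul_meas_ge_le_lintegral₀ (μ := μ) (f := fun ω => ENNReal.ofReal
      (√(ρ / (proxy σ i (state K ε δ init O (fun n => X n ω) t) + ρ))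
        * Real.exp (dev B i (state K ε δ init O (fun n => X n ω) t) ^ 2
          / (2 * (proxy σ i (state K ε δ init O (fun n => X n ω) t) + ρ))))) (by
      have hst := measurable_state_path (K := K) (ε := ε) (δ := δ) (init := init) hO hX t
      have h1 := (measurable_dev B i).comp hst
      have h2 := (measurable_proxy σ i).comp hst
      simp only [Function.comp_def] at h1 h2
      fun_prop) (ENNReal.ofReal c)).trans hmix
  have hsub : {ω | (4 * σ ^ 2 + 3 / 2) * (state K ε δ init O (fun n => X n ω) t).count i
        * Real.log r < dev B i (state K ε δ init O (fun n => X n ω) t) ^ 2}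
      ⊆ {ω | ENNReal.ofReal c ≤ ENNReal.ofReal
      (√(ρ / (proxy σ i (state K ε δ init O (fun n => X n ω) t) + ρ))
        * Real.exp (dev B i (state K ε δ init O (fun n => X n ω) t) ^ 2
          / (2 * (proxy σ i (state K ε δ init O (fun n => X n ω) t) + ρ))))} := by
    intro ω hω
    obtain ⟨hs1, hs2⟩ := count_state_bounds (K := K) (ε := ε) (δ := δ) (init := init) (O := O)
      (fun n => X n ω) i t
    simp only [Set.mem_ofPred_eq] at hω ⊢
    refine ENNReal.ofReal_le_ofReal ?_
    set st := state K ε δ init O (fun n => X n ω) t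
    have hs1' : (1 : ℝ) ≤ st.count i := mod_cast hs1
    have hs2' : (st.count i : ℝ) ≤ r := by rw [hr]; exact_mod_cast hs2
    unfold proxy
    set k : ℝ := (st.count i : ℝ)
    have hVe : k / 4 + σ ^ 2 * (k - 1) + ρ = k * (σ ^ 2 + 1 / 4) + 1 / 8 := by
      rw [hρdef]; ring
    rw [hVe]
    have hp : 0 < k * (σ ^ 2 + 1 / 4) + 1 / 8 := by positivity
    -- From `1 ≤ k ≤ r`: `k / 4 + 1 / 8 ≤ 3 r / 8` and `k σ ^ 2 ≤ 3 r σ ^ 2`.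
    have h1 : 1 / √(3 * r) ≤ √(ρ / (k * (σ ^ 2 + 1 / 4) + 1 / 8)) := by
      rw [one_div, ← Real.sqrt_inv, ← one_div]
      refine Real.sqrt_le_sqrt ?_
      rw [div_le_div_iff₀ (by positivity) hp, hρdef]
      nlinarith [sq_nonneg σ, mul_nonneg (sub_nonneg.2 hs1') (sq_nonneg σ),
        mul_nonneg (sub_nonneg.2 hs2') (sq_nonneg σ)]
    -- The constant `4 σ ^ 2 + 3/2` enters here: `4 k σ ^ 2 + k + 1/2 ≤ (4 σ ^ 2 + 3/2) k` because
    -- `k ≥ 1`.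
    have h2 : r ^ 2 ≤ Real.exp (dev B i st ^ 2 / (2 * (k * (σ ^ 2 + 1 / 4) + 1 / 8))) := by
      have : r ^ 2 = Real.exp (2 * Real.log r) := by
        rw [two_mul, Real.exp_add, Real.exp_log (by linarith)]; ring
      rw [this]
      refine Real.exp_le_exp.2 ?_
      rw [le_div_iff₀ (by positivity)]
      refine le_trans ?_ hω.le
      nlinarith [mul_nonneg hlog (sub_nonneg.2 hs1')]
    have h3 : c = 1 / √(3 * r) * r ^ 2 := by
      rw [hc, Real.sqrt_mul (by norm_num)]
      have h3 : √3 ≠ 0 := (Real.sqrt_pos.2 (by norm_num)).ne'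
      have hr0 : √r ≠ 0 := (Real.sqrt_pos.2 (by linarith)).ne'
      have := Real.sq_sqrt (by linarith : 0 ≤ r)
      field_simp
      rw [this]
    rw [h3]
    exact mul_le_mul h1 h2 (by positivity) (by positivity)
  have hle : μ {ω | (4 * σ ^ 2 + 3 / 2) * (state K ε δ init O (fun n => X n ω) t).count i
        * Real.log r < dev B i (state K ε δ init O (fun n => X n ω) t) ^ 2}
      ≤ ENNReal.ofReal (1 / c) := by
    rw [one_div, ENNReal.ofReal_inv_of_pos hc0, ENNReal.le_inv_iff_mul_le]
    rw [mul_comm]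
    exact (mul_le_mul_right (measure_mono hsub) _).trans hmarkov
  have hfin : 1 / c = √3 / (r * √r) := by rw [hc, one_div_div]
  rw [← hfin]
  exact ENNReal.toReal_le_of_le_ofReal (by positivity) hle

end Path

end CUCB

/-! ### Gaps, optimistic vectors and the approximation oracle. -/

namespace SemiBandit

variable {m : ℕ} (B : SemiBandit m)

theorem mean_mem (i : Fin m) : B.mean i ∈ Set.Icc (0 : ℝ) 1 := by
  have h : ∀ᵐ x ∂B.law, x i ∈ Set.Icc (0 : ℝ) 1 := by
    filter_upwards [B.law_cube] with x hx using hx i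
  have hint : Integrable (fun x : Fin m → ℝ => x i) B.law :=
    Integrable.of_mem_Icc 0 1 (measurable_pi_apply i).aemeasurable h
  constructor
  · exact integral_nonneg_of_ae (by filter_upwards [h] with x hx using hx.1)
  · have := integral_mono_ae hint (integrable_const (1 : ℝ))
      (by filter_upwards [h] with x hx using hx.2)
    simpa [mean] using this

theorem reward_le_opt {S : Finset (Fin m)} (hS : S ∈ B.superArms) (v : Fin m → ℝ) :
    B.reward S v ≤ B.opt v :=
  Finset.le_sup' (fun S => B.reward S v) hS

theorem opt_mono : Monotone B.opt := fun _ _ hvw =>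
  Finset.sup'_le _ _ fun S hS => (B.reward_mono S hS hvw).trans (B.reward_le_opt hS _)

theorem reward_mean_nonneg {S : Finset (Fin m)} (hS : S ∈ B.superArms) :
    0 ≤ B.reward S B.mean :=
  B.reward_nonneg S hS _ B.mean_mem

theorem opt_mean_nonneg : 0 ≤ B.opt B.mean := by
  obtain ⟨S, hS⟩ := B.superArms_nonempty
  exact (B.reward_mean_nonneg hS).trans (B.reward_le_opt hS _)

variable {α : ℝ}

theorem finite_gaps :
    ((fun S => α * B.opt B.mean - B.reward S B.mean) '' B.bad α).Finite :=
  (Set.toFinite _).image _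

theorem gap_le_gapMax {S : Finset (Fin m)} (hS : S ∈ B.bad α) :
    α * B.opt B.mean - B.reward S B.mean ≤ B.gapMax α :=
  le_csSup B.finite_gaps.bddAbove (Set.mem_image_of_mem _ hS)

theorem gapMin_le_gap {S : Finset (Fin m)} (hS : S ∈ B.bad α) :
    B.gapMin α ≤ α * B.opt B.mean - B.reward S B.mean :=
  csInf_le B.finite_gaps.bddBelow (Set.mem_image_of_mem _ hS)

theorem gapMax_nonneg : 0 ≤ B.gapMax α := by
  refine Real.sSup_nonneg ?_
  rintro _ ⟨S, hS, rfl⟩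
  exact sub_nonneg.2 hS.2.le

theorem gap_le_gapMax_of_mem {S : Finset (Fin m)} (hS : S ∈ B.superArms) :
    α * B.opt B.mean - B.gapMax α ≤ B.reward S B.mean := by
  by_cases h : B.reward S B.mean < α * B.opt B.mean
  · have := B.gap_le_gapMax ⟨hS, h⟩
    linarith
  · have := B.gapMax_nonneg (α := α)
    linarith

theorem gapMax_eq_zero (h : ¬ (B.bad α).Nonempty) : B.gapMax α = 0 := by
  rw [gapMax, Set.not_nonempty_iff_eq_empty.1 h, Set.image_empty, Real.sSup_empty]

/-- A bad super arm contains a base arm. -/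
theorem nonempty_of_bad (hα : α ≤ 1) (hbad : (B.bad α).Nonempty) :
    ∃ S ∈ B.superArms, S.Nonempty := by
  by_contra! h
  -- If every super arm were empty, a bad one would itself be optimal, contradicting `α ≤ 1` and a
  -- nonnegative optimum.
  obtain ⟨S, hS, hlt⟩ := hbad
  obtain ⟨S', hS', hopt⟩ := Finset.exists_mem_eq_sup' B.superArms_nonempty
    fun S => B.reward S B.mean
  have h1 : B.opt B.mean = B.reward S B.mean := by
    rw [opt, hopt, h S hS, h S' hS']
  have := B.opt_mean_nonneg
  rw [← h1] at hlt
  nlinarith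

/-- A bad super arm that looks good under the upper confidence vector `v` contains an arm whose
confidence bound is loose. -/
theorem exists_loose_arm {f : ℝ → ℝ} (hα0 : 0 < α) (hf : StrictMonoOn f (Set.Ici 0))
    (hsm : B.BoundedSmooth f) {L : ℝ} (hL : 0 < L) (hfL : f L = B.gapMin α)
    {S : Finset (Fin m)} (hS : S ∈ B.bad α) {v : Fin m → ℝ} (hv : B.mean ≤ v)
    (hgood : α * B.opt v ≤ B.reward S v) : ∃ i ∈ S, L ≤ v i - B.mean i := by
  by_contra! h
  -- Finiteness of `S` yields a deviation bound strictly below `L`; then `f d < f L = Δ_min` by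
  -- strict monotonicity, which contradicts the gap of `S`.
  obtain ⟨d, hd0, hdL, hd⟩ : ∃ d, 0 ≤ d ∧ d < L ∧ ∀ i ∈ S, |v i - B.mean i| ≤ d := by
    rcases S.eq_empty_or_nonempty with rfl | hne
    · exact ⟨0, le_rfl, hL, by simp⟩
    · obtain ⟨j, hj, hmax⟩ := S.exists_max_image (fun i => v i - B.mean i) hne
      refine ⟨v j - B.mean j, sub_nonneg.2 (hv j), h j hj, fun i hi => ?_⟩
      rw [abs_of_nonneg (sub_nonneg.2 (hv i))]
      exact hmax i hi
  have h1 := (le_abs_self _).trans (hsm S hS.1 v B.mean d hd0 hd)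
  have h2 := hf hd0 hL.le hdL
  have h3 := B.gapMin_le_gap hS
  have h4 := mul_le_mul_of_nonneg_left (B.opt_mono hv) hα0.le
  linarith

/-- Expected reward of the oracle's answer to an upper confidence vector. -/
theorem oracle_reward_ge {f : ℝ → ℝ} {β : ℝ} {Ξ : Type*} [MeasurableSpace Ξ] {ν : Measure Ξ}
    [IsProbabilityMeasure ν] {O : (Fin m → ℝ) → Ξ → Finset (Fin m)} (hO : B.IsOracle ν α β O)
    (hα0 : 0 < α) (hf : StrictMonoOn f (Set.Ici 0))
    (hsm : B.BoundedSmooth f) {L : ℝ} (hL : 0 < L) (hfL : f L = B.gapMin α)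
    {v : Fin m → ℝ} (hv : B.mean ≤ v) {c : Ξ → ℝ} (hc0 : ∀ ξ, 0 ≤ c ξ)
    (hc : ∀ ξ, (∃ i ∈ O v ξ, L ≤ v i - B.mean i) → 1 ≤ c ξ)
    (hint : Integrable (fun ξ => B.reward (O v ξ) B.mean + B.gapMax α * c ξ) ν) :
    α * β * B.opt B.mean ≤ ∫ ξ, B.reward (O v ξ) B.mean + B.gapMax α * c ξ ∂ν := by
  set G := {ξ | α * B.opt v ≤ B.reward (O v ξ) v}
  have hG : MeasurableSet G :=
    measurable_prodMk_left (x := v)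
      (CUCB.measurableSet_oracle hO.meas fun S => α * B.opt v ≤ B.reward S v)
  have hopt := B.opt_mean_nonneg
  have hβ := hO.approx v (hopt.trans (B.opt_mono hv))
  have hΔ := B.gapMax_nonneg (α := α)
  -- When the oracle succeeds, a bad answer is compensated by `c ≥ 1`; when it fails, nonnegativity
  -- suffices. Integrating the indicator produces the factor `β`.
  have hpt : ∀ ξ, G.indicator (fun _ => α * B.opt B.mean) ξ
      ≤ B.reward (O v ξ) B.mean + B.gapMax α * c ξ := by
    intro ξ
    have hr := B.reward_mean_nonneg (hO.mem v ξ)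
    have hcξ := mul_nonneg hΔ (hc0 ξ)
    by_cases hξ : ξ ∈ G
    · rw [Set.indicator_of_mem hξ]
      by_cases hb : B.reward (O v ξ) B.mean < α * B.opt B.mean
      · have hbad : O v ξ ∈ B.bad α := ⟨hO.mem v ξ, hb⟩
        have h1 := hc ξ (B.exists_loose_arm hα0 hf hsm hL hfL hbad hv hξ)
        have h2 := B.gap_le_gapMax hbad
        nlinarith
      · linarith
    · rw [Set.indicator_of_notMem hξ]
      linarith
  have h := integral_mono ((integrable_const _).indicator hG) hint hpt
  rw [integral_indicator_const _ hG, smul_eq_mul] at h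
  refine le_trans ?_ h
  have := mul_le_mul_of_nonneg_right hβ (mul_nonneg hα0.le hopt)
  linarith

end SemiBandit

/-! ### Width of the confidence intervals. -/

namespace CUCB

/-- The width of the confidence interval in units of `√(log t / T_i)`. -/
theorem sq_width_le {K : ℕ} {ε δ : ℝ} (hK : 1 ≤ K) (hε : 0 < ε) (hδ0 : 0 < δ) (hδ : δ < 1) :
    (√(4 * sigma K ε δ ^ 2 + 3 / 2) + (√(3 / 2) + 2 * sigma K ε δ)) ^ 2
      ≤ 128 * K * Real.log (1.25 / δ) / min (ε ^ 2) 2 := by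
  have hL : 0.223 ≤ Real.log (1.25 / δ) := by
    refine log_five_quarters_ge.trans (Real.log_le_log (by norm_num) ?_)
    rw [le_div_iff₀ hδ0]
    nlinarith
  have hKL : 0.223 ≤ K * Real.log (1.25 / δ) := by
    have : (1 : ℝ) ≤ K := mod_cast hK
    nlinarith
  have hσ0 : 0 ≤ sigma K ε δ := by unfold sigma; positivity
  have hσ2 : sigma K ε δ ^ 2 * ε ^ 2 = 2 * (K * Real.log (1.25 / δ)) := by
    rw [sigma, mul_pow, Real.sq_sqrt (by linarith)]
    field_simp
  set σ := sigma K ε δ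
  -- The two sides of the minimum serve two purposes: `ε ^ 2` gives `A ≥ 64 σ ^ 2`, and `2` gives `A
  -- ≥ 64 · 0.223`, which absorbs the terms free of `σ`.
  set A := 128 * K * Real.log (1.25 / δ) / min (ε ^ 2) 2 with hA
  have hmin : 0 < min (ε ^ 2) 2 := lt_min (by positivity) (by norm_num)
  have hA1 : 64 * σ ^ 2 ≤ A := by
    rw [hA, le_div_iff₀ hmin]
    have := mul_le_mul_of_nonneg_left (min_le_left (ε ^ 2) 2) (sq_nonneg σ)
    nlinarith
  have hA2 : 14.272 ≤ A := by
    rw [hA, le_div_iff₀ hmin]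
    have := min_le_right (ε ^ 2) 2
    nlinarith
  have hA0 : 0 ≤ A := by linarith
  have ha := Real.sq_sqrt hA0
  have ha0 := Real.sqrt_nonneg A
  have ha1 : 3.7 ≤ √A := Real.le_sqrt_of_sq_le (by norm_num; linarith)
  set a := √A
  have hσa : σ ≤ a / 8 := by
    refine (sq_le_sq₀ hσ0 (by positivity)).1 ?_
    nlinarith
  have h32 : √(3 / 2 : ℝ) ≤ 1.2248 := by
    rw [Real.sqrt_le_left (by norm_num)]; norm_num
  -- The share of `a` left after `2 σ ≤ a / 4` and `√(3/2) ≤ 1.2248`; the lower bound `a ≥ 3.7`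
  -- makes it large enough.
  have hroot : √(4 * σ ^ 2 + 3 / 2) ≤ 3 * a / 4 - 1.2248 := by
    rw [Real.sqrt_le_left (by linarith)]
    nlinarith
  have hsum : √(4 * σ ^ 2 + 3 / 2) + (√(3 / 2) + 2 * σ) ≤ a := by linarith
  rw [← ha]
  exact pow_le_pow_left₀ (by positivity) hsum 2

variable {m : ℕ} {K : ℕ} {ε δ : ℝ}

theorem ucb_eq {t : ℕ} (ht : 1 ≤ t) (s : State m) (i : Fin m) :
    ucb K ε δ t s i
      = s.est i + (√(3 / 2) + 2 * sigma K ε δ) * √(Real.log t / s.count i) := by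
  have hlog : 0 ≤ Real.log t / s.count i :=
    div_nonneg (Real.log_nonneg (mod_cast ht)) (Nat.cast_nonneg _)
  have h1 : 3 * Real.log t / (2 * s.count i) = 3 / 2 * (Real.log t / s.count i) := by
    rw [mul_div_mul_comm]
  have h2 : 2 * K * Real.log (1.25 / δ) * Real.log t / s.count i
      = 2 * K * Real.log (1.25 / δ) * (Real.log t / s.count i) := mul_div_assoc _ _ _
  rw [ucb, sigma, h1, h2, Real.sqrt_mul' _ hlog, Real.sqrt_mul' _ hlog]
  ring

theorem abs_est_sub_le {B : SemiBandit m} {t : ℕ} (ht : 1 ≤ t) {s : State m} {i : Fin m}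
    (hs : 1 ≤ s.count i) {κ : ℝ} (hκ : 0 ≤ κ)
    (hdev : dev B i s ^ 2 ≤ κ * s.count i * Real.log t) :
    |s.est i - B.mean i| ≤ √κ * √(Real.log t / s.count i) := by
  have hk : (0 : ℝ) < s.count i := by exact_mod_cast hs
  have hlog : 0 ≤ Real.log t := Real.log_nonneg (mod_cast ht)
  rw [← Real.sqrt_mul hκ]
  refine Real.abs_le_sqrt ?_
  rw [mul_div_assoc', le_div_iff₀ hk]
  refine le_of_mul_le_mul_right ?_ hk
  rw [dev] at hdev
  nlinarith

/-- Optimism: `4 σ ^ 2 + 3/2 ≤ (√(3/2) + 2 σ) ^ 2`, so the exploration bonus covers the deviation.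
-/
theorem mean_le_ucb {B : SemiBandit m} (hε : 0 < ε) {t : ℕ} (ht : 1 ≤ t) {s : State m} {i : Fin m}
    (hs : 1 ≤ s.count i)
    (hdev : dev B i s ^ 2 ≤ (4 * sigma K ε δ ^ 2 + 3 / 2) * s.count i * Real.log t) :
    B.mean i ≤ ucb K ε δ t s i := by
  have h := (abs_le.1 (abs_est_sub_le ht hs (by positivity) hdev)).1
  have hσ0 : 0 ≤ sigma K ε δ := by unfold sigma; positivity
  have hκ : √(4 * sigma K ε δ ^ 2 + 3 / 2) ≤ √(3 / 2) + 2 * sigma K ε δ := by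
    rw [Real.sqrt_le_left (by positivity)]
    nlinarith [Real.sq_sqrt (show (0 : ℝ) ≤ 3 / 2 by norm_num),
      mul_nonneg hσ0 (Real.sqrt_nonneg (3 / 2))]
  have := mul_le_mul_of_nonneg_right hκ (Real.sqrt_nonneg (Real.log t / s.count i))
  rw [ucb_eq ht]
  linarith

/-- Deviation plus bonus is a constant times `√(log t / count)`. If this is at least `L`, squaring
bounds the count; replacing `t` by `T` makes the bound uniform over the rounds. -/
theorem count_le_of_loose {B : SemiBandit m} (hK : 1 ≤ K) (hε : 0 < ε) (hδ0 : 0 < δ) (hδ : δ < 1)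
    {t T : ℕ} (ht : 1 ≤ t) (htT : t ≤ T) {s : State m} {i : Fin m} (hs : 1 ≤ s.count i)
    (hdev : dev B i s ^ 2 ≤ (4 * sigma K ε δ ^ 2 + 3 / 2) * s.count i * Real.log t)
    {L : ℝ} (hL : 0 < L) (hloose : L ≤ ucb K ε δ t s i - B.mean i) :
    (s.count i : ℝ)
      ≤ 128 * K * Real.log (1.25 / δ) * Real.log T / (min (ε ^ 2) 2 * L ^ 2) := by
  have h := (abs_le.1 (abs_est_sub_le ht hs (by positivity) hdev)).2
  have hk : (0 : ℝ) < s.count i := by exact_mod_cast hs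
  have ht' : (1 : ℝ) ≤ t := mod_cast ht
  have hlog : 0 ≤ Real.log t := Real.log_nonneg ht'
  have hlogT : Real.log t ≤ Real.log T := Real.log_le_log (by linarith) (mod_cast htT)
  rw [ucb_eq ht] at hloose
  have hA := sq_width_le hK hε hδ0 hδ
  have hmin : 0 < min (ε ^ 2) 2 := lt_min (by positivity) (by norm_num)
  have hLq : L ≤ (√(4 * sigma K ε δ ^ 2 + 3 / 2) + (√(3 / 2) + 2 * sigma K ε δ))
      * √(Real.log t / s.count i) := by linarith
  have hsq := pow_le_pow_left₀ hL.le hLq 2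
  rw [mul_pow, Real.sq_sqrt (by positivity), mul_div_assoc', le_div_iff₀ hk] at hsq
  set W := (√(4 * sigma K ε δ ^ 2 + 3 / 2) + (√(3 / 2) + 2 * sigma K ε δ)) ^ 2
  have hfin : L ^ 2 * s.count i ≤ 128 * K * Real.log (1.25 / δ) / min (ε ^ 2) 2 * Real.log T :=
    hsq.trans (mul_le_mul hA hlogT hlog ((sq_nonneg _).trans hA))
  rw [div_mul_eq_mul_div, le_div_iff₀ hmin] at hfin
  rw [le_div_iff₀ (by positivity)]
  linarith

end CUCB

/-! ### Charging the loss of each round to arms, and summation over rounds. -/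

namespace CUCB

variable {m : ℕ} {Ξ : Type*} {K : ℕ} {ε δ : ℝ} {init : ℕ → Finset (Fin m)}
  {O : (Fin m → ℝ) → Ξ → Finset (Fin m)}

/-- The memories for which the confidence bound of arm `i` fails in round `t`. -/
def devSet (B : SemiBandit m) (K : ℕ) (ε δ : ℝ) (t : ℕ) (i : Fin m) : Set (State m) :=
  {s | (4 * sigma K ε δ ^ 2 + 3 / 2) * s.count i * Real.log t < dev B i s ^ 2}

/-- Arm `i` is played in round `t` although it has been observed at most `b` times. -/
def rareSet (K : ℕ) (ε δ : ℝ) (init : ℕ → Finset (Fin m)) (O : (Fin m → ℝ) → Ξ → Finset (Fin m))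
    (b : ℝ) (t : ℕ) (i : Fin m) : Set (State m × Ξ) :=
  {p | i ∈ pick K ε δ init O t p.1 p.2 ∧ (p.1.count i : ℝ) ≤ b}

/-- The number of arms to which the loss of round `t` is charged. -/
noncomputable def charge (B : SemiBandit m) (K : ℕ) (ε δ : ℝ) (init : ℕ → Finset (Fin m))
    (O : (Fin m → ℝ) → Ξ → Finset (Fin m)) (b : ℝ) (t : ℕ) (p : State m × Ξ) : ℝ :=
  ∑ i, ((devSet B K ε δ t i).indicator 1 p.1 + (rareSet K ε δ init O b t i).indicator 1 p)

theorem charge_nonneg (B : SemiBandit m) (b : ℝ) (t : ℕ) (p : State m × Ξ) :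
    0 ≤ charge B K ε δ init O b t p :=
  Finset.sum_nonneg fun _ _ => add_nonneg (Set.indicator_nonneg (fun _ _ => zero_le_one) _)
    (Set.indicator_nonneg (fun _ _ => zero_le_one) _)

theorem charge_le (B : SemiBandit m) (b : ℝ) (t : ℕ) (p : State m × Ξ) :
    charge B K ε δ init O b t p ≤ 2 * m := by
  have h : ∀ i ∈ Finset.univ, (devSet B K ε δ t i).indicator (1 : State m → ℝ) p.1
      + (rareSet K ε δ init O b t i).indicator 1 p ≤ 2 := fun i _ => by
    have h1 : (devSet B K ε δ t i).indicator (1 : State m → ℝ) p.1 ≤ 1 :=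
      Set.indicator_le_self' (fun _ _ => zero_le_one) _
    have h2 : (rareSet K ε δ init O b t i).indicator (1 : State m × Ξ → ℝ) p ≤ 1 :=
      Set.indicator_le_self' (fun _ _ => zero_le_one) _
    linarith
  refine (Finset.sum_le_card_nsmul _ _ 2 h).trans ?_
  simp [mul_comm]

theorem one_le_charge_of_dev (B : SemiBandit m) (b : ℝ) (t : ℕ) {p : State m × Ξ} {i : Fin m}
    (h : p.1 ∈ devSet B K ε δ t i) : 1 ≤ charge B K ε δ init O b t p := by
  refine le_trans ?_ (Finset.single_le_sum (fun i _ =>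
    add_nonneg (Set.indicator_nonneg (fun _ _ => zero_le_one) _)
      (Set.indicator_nonneg (fun _ _ => zero_le_one) _)) (Finset.mem_univ i))
  rw [Set.indicator_of_mem h]
  exact le_add_of_nonneg_right (Set.indicator_nonneg (fun _ _ => zero_le_one) _)

theorem one_le_charge_of_rare (B : SemiBandit m) (b : ℝ) (t : ℕ) {p : State m × Ξ} {i : Fin m}
    (h : p ∈ rareSet K ε δ init O b t i) : 1 ≤ charge B K ε δ init O b t p := by
  refine le_trans ?_ (Finset.single_le_sum (fun i _ =>
    add_nonneg (Set.indicator_nonneg (fun _ _ => zero_le_one) _)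
      (Set.indicator_nonneg (fun _ _ => zero_le_one) _)) (Finset.mem_univ i))
  rw [Set.indicator_of_mem h]
  exact le_add_of_nonneg_left (Set.indicator_nonneg (fun _ _ => zero_le_one) _)

theorem measurableSet_devSet (B : SemiBandit m) (t : ℕ) (i : Fin m) :
    MeasurableSet (devSet B K ε δ t i) := by
  have hc : Measurable fun s : State m => (s.count i : ℝ) :=
    measurable_from_top.comp (measurable_count_apply i)
  exact measurableSet_lt (by fun_prop) ((measurable_dev B i).pow_const 2)

/-- Each play of a rarely observed arm increases its number of observations. -/
theorem sum_rare_le (x : ℕ → Sample m Ξ) {b : ℝ} (hb : 0 ≤ b) (i : Fin m) (T : ℕ) :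
    ∑ n ∈ Finset.range T, (if n + 1 ≤ m then 0 else (rareSet K ε δ init O b (n + 1) i).indicator
      (1 : State m × Ξ → ℝ) (state K ε δ init O x n, (x (n + 1)).2.2)) ≤ b := by
  -- The induction also carries the bound `count - 1`: at a rare play the old count is at most `b`,
  -- so the sum including the new play is at most `b` again.
  suffices h : ∑ n ∈ Finset.range T, (if n + 1 ≤ m then 0 else
      (rareSet K ε δ init O b (n + 1) i).indicator
        (1 : State m × Ξ → ℝ) (state K ε δ init O x n, (x (n + 1)).2.2)) ≤ b ∧
      ∑ n ∈ Finset.range T, (if n + 1 ≤ m then 0 else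
        (rareSet K ε δ init O b (n + 1) i).indicator
          (1 : State m × Ξ → ℝ) (state K ε δ init O x n, (x (n + 1)).2.2))
        ≤ (state K ε δ init O x T).count i - 1 from h.1
  induction T with
  | zero => simp [state, hb]
  | succ T ih =>
    rw [Finset.sum_range_succ, state_succ, step]
    split_ifs with h
    · simpa using ih
    have hmono : ((state K ε δ init O x T).count i : ℝ)
        ≤ (update (pick K ε δ init O (T + 1) (state K ε δ init O x T) (x (T + 1)).2.2)
          (x (T + 1)) (state K ε δ init O x T)).count i := by
      simp only [update]
      split_ifs <;> simp
    by_cases hr : (state K ε δ init O x T, (x (T + 1)).2.2) ∈ rareSet K ε δ init O b (T + 1) i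
    · rw [Set.indicator_of_mem hr]
      have e : (update (pick K ε δ init O (T + 1) (state K ε δ init O x T) (x (T + 1)).2.2)
          (x (T + 1)) (state K ε δ init O x T)).count i
          = (state K ε δ init O x T).count i + 1 := if_pos hr.1
      rw [e]
      have := hr.2
      dsimp only at this
      push_cast
      constructor <;> simp only [Pi.one_apply] <;> linarith [ih.2]
    · rw [Set.indicator_of_notMem hr, add_zero]
      exact ⟨ih.1, ih.2.trans (by linarith)⟩

variable [MeasurableSpace Ξ]

theorem measurableSet_rareSet (hO : ∀ S, MeasurableSet {p : (Fin m → ℝ) × Ξ | O p.1 p.2 = S})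
    (b : ℝ) (t : ℕ) (i : Fin m) : MeasurableSet (rareSet K ε δ init O b t i) := by
  have hc : Measurable fun p : State m × Ξ => (p.1.count i : ℝ) :=
    measurable_from_top.comp ((measurable_count_apply i).comp measurable_fst)
  exact (measurableSet_pick hO t fun S => i ∈ S).inter (measurableSet_le hc measurable_const)

theorem measurable_pick (hO : ∀ S, MeasurableSet {p : (Fin m → ℝ) × Ξ | O p.1 p.2 = S})
    (t : ℕ) (g : Finset (Fin m) → ℝ) :
    Measurable fun p : State m × Ξ => g (pick K ε δ init O t p.1 p.2) := fun A _ =>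
  measurableSet_pick hO t fun S => g S ∈ A

theorem measurable_charge (hO : ∀ S, MeasurableSet {p : (Fin m → ℝ) × Ξ | O p.1 p.2 = S})
    (B : SemiBandit m) (b : ℝ) (t : ℕ) :
    Measurable (charge B K ε δ init O b t) := by
  refine Finset.measurable_sum _ fun i _ => ?_
  exact ((measurable_one.indicator (measurableSet_devSet B t i)).comp measurable_fst).add
    (measurable_one.indicator (measurableSet_rareSet hO b t i))

theorem integrable_reward_add_charge
    (hO : ∀ S, MeasurableSet {p : (Fin m → ℝ) × Ξ | O p.1 p.2 = S})
    (B : SemiBandit m) (b c : ℝ) (t : ℕ) (P : Measure (State m × Ξ)) [IsFiniteMeasure P] :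
    Integrable (fun p => B.reward (pick K ε δ init O t p.1 p.2) B.mean
      + c * charge B K ε δ init O b t p) P := by
  refine Integrable.add ?_ (Integrable.const_mul ?_ c)
  · refine Integrable.of_bound
      (measurable_pick hO t fun S => B.reward S B.mean).aestronglyMeasurable
      (∑ S, |B.reward S B.mean|) (Filter.Eventually.of_forall fun p => ?_)
    exact Finset.single_le_sum (f := fun S => |B.reward S B.mean|)
      (fun S _ => abs_nonneg _) (Finset.mem_univ _)
  · refine Integrable.of_bound (measurable_charge hO B b t).aestronglyMeasurable
      (2 * m) (Filter.Eventually.of_forall fun p => ?_)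
    rw [Real.norm_of_nonneg (charge_nonneg B b t p)]
    exact charge_le B b t p

theorem play_mem {ν : Measure Ξ} {B : SemiBandit m} {α β : ℝ}
    (hO : B.IsOracle ν α β O) (hinit : ∀ t, init t ∈ B.superArms)
    (x : ℕ → Sample m Ξ) (n : ℕ) : play K ε δ init O x (n + 1) ∈ B.superArms := by
  rw [play_succ, pick]
  split_ifs
  · exact hinit _
  · exact hO.mem _ _

variable {ν : Measure Ξ} [IsProbabilityMeasure ν] {B : SemiBandit m} {α β : ℝ} {f : ℝ → ℝ}

/-- Expected reward of round `t`, given the memory `s`. -/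
theorem integral_round_ge (hα0 : 0 < α) (hβ : β ≤ 1) (hε : 0 < ε) (hδ0 : 0 < δ) (hδ : δ < 1)
    (hK : 1 ≤ K) (hf : StrictMonoOn f (Set.Ici 0)) (hsm : B.BoundedSmooth f)
    {L : ℝ} (hL : 0 < L) (hfL : f L = B.gapMin α) (hO : B.IsOracle ν α β O)
    {t T : ℕ} (htm : ¬ t ≤ m) (htT : t ≤ T) {s : State m} (hs : ∀ i, 1 ≤ s.count i) :
    α * β * B.opt B.mean ≤ ∫ ξ, B.reward (pick K ε δ init O t s ξ) B.mean + B.gapMax α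
      * charge B K ε δ init O
        (128 * K * Real.log (1.25 / δ) * Real.log T / (min (ε ^ 2) 2 * L ^ 2)) t (s, ξ) ∂ν := by
  set b := 128 * K * Real.log (1.25 / δ) * Real.log T / (min (ε ^ 2) 2 * L ^ 2)
  have ht1 : 1 ≤ t := by omega
  have hΔ := B.gapMax_nonneg (α := α)
  have hint : Integrable (fun ξ => B.reward (pick K ε δ init O t s ξ) B.mean + B.gapMax α
      * charge B K ε δ init O b t (s, ξ)) ν := by
    have h := integrable_reward_add_charge (init := init) (K := K) (ε := ε) (δ := δ) hO.meas B b
      (B.gapMax α) t (ν.map fun ξ => (s, ξ))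
    exact h.comp_measurable measurable_prodMk_left
  have hmem : ∀ ξ, pick K ε δ init O t s ξ = O (ucb K ε δ t s) ξ := fun ξ => if_neg htm
  -- A failed confidence bound already gives charge at least 1, which pays for the largest possible
  -- gap; otherwise the vector is optimistic and the oracle estimate applies.
  by_cases hdev : ∃ i, s ∈ devSet B K ε δ t i
  · obtain ⟨i, hi⟩ := hdev
    have h := integral_mono (integrable_const (α * β * B.opt B.mean)) hint fun ξ => by
      have h1 : 1 ≤ charge B K ε δ init O b t (s, ξ) := one_le_charge_of_dev B b t hi
      have h2 := B.gap_le_gapMax_of_mem (α := α) (hO.mem (ucb K ε δ t s) ξ)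
      rw [← hmem] at h2
      have h3 : α * β * B.opt B.mean ≤ α * B.opt B.mean := by
        have := mul_le_mul_of_nonneg_right hβ (mul_nonneg hα0.le B.opt_mean_nonneg)
        linarith
      dsimp only
      nlinarith
    simpa using h
  · push Not at hdev
    have hdev' : ∀ i, dev B i s ^ 2
        ≤ (4 * sigma K ε δ ^ 2 + 3 / 2) * s.count i * Real.log t := fun i => not_lt.1 (hdev i)
    have hv : B.mean ≤ ucb K ε δ t s := fun i => mean_le_ucb hε ht1 (hs i) (hdev' i)
    simp_rw [hmem] at hint ⊢
    refine B.oracle_reward_ge hO hα0 hf hsm hL hfL hv (fun ξ => charge_nonneg B b t _) ?_ hint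
    rintro ξ ⟨i, hi, hloose⟩
    refine one_le_charge_of_rare B b t (i := i) ⟨?_, ?_⟩
    · rw [hmem]
      exact hi
    · exact count_le_of_loose hK hε hδ0 hδ ht1 htT (hs i) (hdev' i) hL hloose

section Path

variable {Ω : Type*} [MeasurableSpace Ω] {μ : Measure Ω} [IsProbabilityMeasure μ]
  {X : ℕ → Ω → Sample m Ξ}

/-- The seed of the round is independent of the memory, so the bound for a fixed memory can be
integrated over the law of the memory. -/
theorem integral_play_ge (hα0 : 0 < α) (hβ : β ≤ 1) (hε : 0 < ε) (hδ0 : 0 < δ) (hδ : δ < 1)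
    (hK : 1 ≤ K) (hf : StrictMonoOn f (Set.Ici 0)) (hsm : B.BoundedSmooth f)
    {L : ℝ} (hL : 0 < L) (hfL : f L = B.gapMin α) (hO : B.IsOracle ν α β O)
    (hX : ∀ t, Measurable (X t)) (hind : iIndepFun X μ)
    (hlaw : ∀ t, μ.map (X t) = sampleLaw B K ε δ ν)
    {n T : ℕ} (htm : ¬ n + 1 ≤ m) (htT : n + 1 ≤ T) :
    α * β * B.opt B.mean ≤ ∫ ω, B.reward (play K ε δ init O (fun n => X n ω) (n + 1)) B.mean
      + B.gapMax α * charge B K ε δ init O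
        (128 * K * Real.log (1.25 / δ) * Real.log T / (min (ε ^ 2) 2 * L ^ 2)) (n + 1)
        (state K ε δ init O (fun n => X n ω) n, (X (n + 1) ω).2.2) ∂μ := by
  set b := 128 * K * Real.log (1.25 / δ) * Real.log T / (min (ε ^ 2) 2 * L ^ 2)
  have hst := measurable_state_path (K := K) (ε := ε) (δ := δ) (init := init) hO.meas hX n
  have hpair : Measurable fun ω =>
      (state K ε δ init O (fun n => X n ω) n, (X (n + 1) ω).2.2) :=
    hst.prodMk (measurable_snd.comp (measurable_snd.comp (hX (n + 1))))
  have : IsProbabilityMeasure (μ.map fun ω => state K ε δ init O (fun n => X n ω) n) :=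
    Measure.isProbabilityMeasure_map hst.aemeasurable
  set G : State m × Ξ → ℝ := fun p => B.reward (pick K ε δ init O (n + 1) p.1 p.2) B.mean
      + B.gapMax α * charge B K ε δ init O b (n + 1) p with hG
  have hGint := integrable_reward_add_charge (init := init) (K := K) (ε := ε) (δ := δ) hO.meas B b
      (B.gapMax α) (n + 1) ((μ.map fun ω => state K ε δ init O (fun n => X n ω) n).prod ν)
  have e : ∫ ω, B.reward (play K ε δ init O (fun n => X n ω) (n + 1)) B.mean
      + B.gapMax α * charge B K ε δ init O b (n + 1)
        (state K ε δ init O (fun n => X n ω) n, (X (n + 1) ω).2.2) ∂μ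
      = ∫ s, ∫ ξ, G (s, ξ) ∂ν ∂(μ.map fun ω => state K ε δ init O (fun n => X n ω) n) := by
    rw [← integral_prod G hGint, ← map_state_seed hO.meas hX hind hlaw n,
      integral_map hpair.aemeasurable]
    · rfl
    · exact ((measurable_pick hO.meas (n + 1) fun S => B.reward S B.mean).add
        ((measurable_charge hO.meas B b (n + 1)).const_mul _)).aestronglyMeasurable
  rw [e]
  have h := integral_mono_ae (integrable_const (α * β * B.opt B.mean)) hGint.integral_prod_left
    (μ := μ.map fun ω => state K ε δ init O (fun n => X n ω) n) (by
      -- An arbitrary memory may have zero counts; only the reachable ones, which carry the law,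
      -- have all counts at least 1.
      have hae : ∀ᵐ s ∂(μ.map fun ω => state K ε δ init O (fun n => X n ω) n),
          ∀ i, 1 ≤ s.count i := by
        refine ae_all_iff.2 fun i => ?_
        rw [ae_map_iff hst.aemeasurable
          (measurableSet_le measurable_const (measurable_count_apply i))]
        exact Filter.Eventually.of_forall fun ω => (count_state_bounds _ i n).1
      filter_upwards [hae] with s hs
      exact integral_round_ge hα0 hβ hε hδ0 hδ hK hf hsm hL hfL hO htm htT hs)
  simpa using h

theorem integrable_reward_play (hO : ∀ S, MeasurableSet {p : (Fin m → ℝ) × Ξ | O p.1 p.2 = S})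
    (hX : ∀ t, Measurable (X t)) (n : ℕ) :
    Integrable (fun ω => B.reward (play K ε δ init O (fun n => X n ω) (n + 1)) B.mean) μ := by
  have hst := measurable_state_path (K := K) (ε := ε) (δ := δ) (init := init) hO hX n
  refine Integrable.of_bound ((measurable_pick hO (n + 1) fun S => B.reward S B.mean).comp
    (hst.prodMk (measurable_snd.comp (measurable_snd.comp (hX (n + 1)))))).aestronglyMeasurable
      (∑ S, |B.reward S B.mean|) (Filter.Eventually.of_forall fun p => ?_)
  exact Finset.single_le_sum (f := fun S => |B.reward S B.mean|)
      (fun S _ => abs_nonneg _) (Finset.mem_univ _)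

theorem integrable_charge (hO : ∀ S, MeasurableSet {p : (Fin m → ℝ) × Ξ | O p.1 p.2 = S})
    (hX : ∀ t, Measurable (X t)) (b : ℝ) (n : ℕ) :
    Integrable (fun ω => charge B K ε δ init O b (n + 1)
      (state K ε δ init O (fun n => X n ω) n, (X (n + 1) ω).2.2)) μ := by
  have hst := measurable_state_path (K := K) (ε := ε) (δ := δ) (init := init) hO hX n
  refine Integrable.of_bound ((measurable_charge hO B b (n + 1)).comp
    (hst.prodMk (measurable_snd.comp (measurable_snd.comp (hX (n + 1)))))).aestronglyMeasurable
      (2 * m) (Filter.Eventually.of_forall fun p => ?_)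
  rw [Real.norm_of_nonneg (charge_nonneg B b _ _)]
  exact charge_le B b _ _

/-- The expected total charge of the rounds after the initialization. -/
theorem sum_integral_charge_le (hm : 1 ≤ m)
    (hO : ∀ S, MeasurableSet {p : (Fin m → ℝ) × Ξ | O p.1 p.2 = S})
    (hX : ∀ t, Measurable (X t)) (hind : iIndepFun X μ)
    (hlaw : ∀ t, μ.map (X t) = sampleLaw B K ε δ ν) {b : ℝ} (hb : 0 ≤ b) (T : ℕ) :
    ∑ n ∈ Finset.range T, (if n + 1 ≤ m then 0 else ∫ ω, charge B K ε δ init O b (n + 1)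
      (state K ε δ init O (fun n => X n ω) n, (X (n + 1) ω).2.2) ∂μ)
      ≤ (b + Real.pi ^ 2 / 3) * m := by
  have hst := fun n => measurable_state_path (K := K) (ε := ε) (δ := δ) (init := init) hO hX n
  have hpair : ∀ n, Measurable fun ω =>
      (state K ε δ init O (fun n => X n ω) n, (X (n + 1) ω).2.2) := fun n =>
    (hst n).prodMk (measurable_snd.comp (measurable_snd.comp (hX (n + 1))))
  have hD : ∀ n i, Integrable (fun ω => (devSet B K ε δ (n + 1) i).indicator (1 : State m → ℝ)
      (state K ε δ init O (fun n => X n ω) n)) μ := fun n i =>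
    (integrable_const (1 : ℝ)).indicator (hst n (measurableSet_devSet B (n + 1) i))
  have hR : ∀ n i, Integrable (fun ω => (rareSet K ε δ init O b (n + 1) i).indicator
      (1 : State m × Ξ → ℝ) (state K ε δ init O (fun n => X n ω) n, (X (n + 1) ω).2.2)) μ :=
    fun n i => (integrable_const (1 : ℝ)).indicator
      (hpair n (measurableSet_rareSet hO b (n + 1) i))
  have hsplit : ∀ n, ∫ ω, charge B K ε δ init O b (n + 1)
      (state K ε δ init O (fun n => X n ω) n, (X (n + 1) ω).2.2) ∂μ
      = ∑ i, (∫ ω, (devSet B K ε δ (n + 1) i).indicator (1 : State m → ℝ)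
          (state K ε δ init O (fun n => X n ω) n) ∂μ
        + ∫ ω, (rareSet K ε δ init O b (n + 1) i).indicator
          (1 : State m × Ξ → ℝ) (state K ε δ init O (fun n => X n ω) n, (X (n + 1) ω).2.2) ∂μ) :=
    fun n => by
      unfold charge
      refine (integral_finsetSum _ fun i _ => (hD n i).add (hR n i)).trans ?_
      exact Finset.sum_congr rfl fun i _ => integral_add (hD n i) (hR n i)
  have hdev : ∀ n i, ∫ ω, (devSet B K ε δ (n + 1) i).indicator (1 : State m → ℝ)
      (state K ε δ init O (fun n => X n ω) n) ∂μ
      ≤ √3 / (((n + 1 : ℕ) : ℝ) * √((n + 1 : ℕ) : ℝ)) := fun n i => by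
    refine le_trans (le_of_eq ?_) (measureReal_dev_le (init := init) hO hX hind hlaw i n)
    exact integral_indicator_one (hst n (measurableSet_devSet B (n + 1) i))
  have hrare : ∀ i, ∑ n ∈ Finset.range T, (if n + 1 ≤ m then 0 else
      ∫ ω, (rareSet K ε δ init O b (n + 1) i).indicator (1 : State m × Ξ → ℝ)
        (state K ε δ init O (fun n => X n ω) n, (X (n + 1) ω).2.2) ∂μ) ≤ b := fun i => by
    have h := integral_mono (μ := μ) (integrable_finsetSum (Finset.range T) fun n _ =>
        (show Integrable (fun ω => if n + 1 ≤ m then 0 else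
          (rareSet K ε δ init O b (n + 1) i).indicator (1 : State m × Ξ → ℝ)
            (state K ε δ init O (fun n => X n ω) n, (X (n + 1) ω).2.2)) μ by
          split_ifs
          · exact integrable_const 0
          · exact hR n i)) (integrable_const b)
      fun ω => sum_rare_le (K := K) (ε := ε) (δ := δ) (init := init) (O := O)
        (fun n => X n ω) hb i T
    rw [integral_finsetSum _ fun n _ =>
        (show Integrable (fun ω => if n + 1 ≤ m then 0 else
          (rareSet K ε δ init O b (n + 1) i).indicator (1 : State m × Ξ → ℝ)
            (state K ε δ init O (fun n => X n ω) n, (X (n + 1) ω).2.2)) μ by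
          split_ifs
          · exact integrable_const 0
          · exact hR n i)] at h
    simp only [integral_const, probReal_univ, smul_eq_mul, one_mul] at h
    refine le_trans (le_of_eq (Finset.sum_congr rfl fun n _ => ?_)) h
    split_ifs <;> simp
  calc ∑ n ∈ Finset.range T, (if n + 1 ≤ m then 0 else ∫ ω, charge B K ε δ init O b (n + 1)
        (state K ε δ init O (fun n => X n ω) n, (X (n + 1) ω).2.2) ∂μ)
      ≤ ∑ n ∈ Finset.range T, ∑ i : Fin m,
          ((if n + 1 ≤ m then 0 else √3 / (((n + 1 : ℕ) : ℝ) * √((n + 1 : ℕ) : ℝ)))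
          + if n + 1 ≤ m then 0 else ∫ ω, (rareSet K ε δ init O b (n + 1) i).indicator
              (1 : State m × Ξ → ℝ)
              (state K ε δ init O (fun n => X n ω) n, (X (n + 1) ω).2.2) ∂μ) := by
        refine Finset.sum_le_sum fun n _ => ?_
        split_ifs
        · simp
        · rw [hsplit]
          exact Finset.sum_le_sum fun i _ => add_le_add_left (hdev n i) _
    _ ≤ ∑ i : Fin m, (Real.pi ^ 2 / 3 + b) := by
        rw [Finset.sum_comm]
        refine Finset.sum_le_sum fun i _ => ?_
        rw [Finset.sum_add_distrib]
        exact add_le_add (sum_sqrt_three_div_le m T hm) (hrare i)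
    _ = (b + Real.pi ^ 2 / 3) * m := by
        simp only [Finset.sum_const, Finset.card_univ, Fintype.card_fin, nsmul_eq_mul]
        ring

theorem regret_eq_sum (hO : ∀ S, MeasurableSet {p : (Fin m → ℝ) × Ξ | O p.1 p.2 = S})
    (hX : ∀ t, Measurable (X t)) (T : ℕ) :
    regret B α β K ε δ init O μ X T = ∑ n ∈ Finset.range T, (α * β * B.opt B.mean
      - ∫ ω, B.reward (play K ε δ init O (fun n => X n ω) (n + 1)) B.mean ∂μ) := by
  rw [regret]
  simp_rw [sum_Icc_one_eq_sum_range]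
  rw [integral_finsetSum _ fun n _ => integrable_reward_play hO hX n, Finset.sum_sub_distrib]
  simp only [Finset.sum_const, Finset.card_range, nsmul_eq_mul]
  ring

/-- The crude bound, from `β ≤ 1` and the largest gap. It serves the initialization rounds and the
case without bad super arms. -/
theorem regret_round_le {ν : Measure Ξ} (hα0 : 0 < α) (hβ : β ≤ 1) (hO : B.IsOracle ν α β O)
    (hinit : ∀ t, init t ∈ B.superArms) (hX : ∀ t, Measurable (X t)) (n : ℕ) :
    α * β * B.opt B.mean
      - ∫ ω, B.reward (play K ε δ init O (fun n => X n ω) (n + 1)) B.mean ∂μ ≤ B.gapMax α := by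
  have h := integral_mono (μ := μ) (integrable_const (α * B.opt B.mean - B.gapMax α))
    (integrable_reward_play (K := K) (ε := ε) (δ := δ) (init := init) (B := B) hO.meas hX n)
    fun ω => B.gap_le_gapMax_of_mem (play_mem hO hinit _ n)
  simp only [integral_const, probReal_univ, smul_eq_mul, one_mul] at h
  have := mul_le_mul_of_nonneg_right hβ (mul_nonneg hα0.le B.opt_mean_nonneg)
  linarith

theorem regret_le (hα0 : 0 < α) (hα : α ≤ 1) (hβ : β ≤ 1) (hε : 0 < ε)
    (hδ0 : 0 < δ) (hδ : δ < 1) (hcard : ∀ S ∈ B.superArms, S.card ≤ K)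
    (hf : StrictMonoOn f (Set.Ici 0)) (hsm : B.BoundedSmooth f)
    (hgap : (B.bad α).Nonempty → B.gapMin α ∈ f '' Set.Ioi 0) (hO : B.IsOracle ν α β O)
    (hinit : ∀ t, init t ∈ B.superArms)
    (hX : ∀ t, Measurable (X t)) (hind : iIndepFun X μ)
    (hlaw : ∀ t, μ.map (X t) = sampleLaw B K ε δ ν) (T : ℕ) :
    regret B α β K ε δ init O μ X T ≤
      (128 * K * Real.log (1.25 / δ) * Real.log T
          / (min (ε ^ 2) 2 * smoothInv f (B.gapMin α) ^ 2)
        + Real.pi ^ 2 / 3 + 1) * m * B.gapMax α := by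
  rw [regret_eq_sum hO.meas hX]
  by_cases hbad : (B.bad α).Nonempty
  swap
  · rw [B.gapMax_eq_zero hbad, mul_zero]
    refine Finset.sum_nonpos fun n _ => ?_
    rw [← B.gapMax_eq_zero hbad]
    exact regret_round_le hα0 hβ hO hinit hX n
  obtain ⟨L, hL, hfL⟩ := hgap hbad
  have hL0 : L ∈ Set.Ici (0 : ℝ) := le_of_lt (Set.mem_Ioi.1 hL)
  -- Injectivity of `f` on `[0, ∞)` identifies the chosen preimage with the positive one.
  have hinv : smoothInv f (B.gapMin α) = L := by
    have hex : ∃ a ∈ Set.Ici (0 : ℝ), f a = B.gapMin α := ⟨L, hL0, hfL⟩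
    exact hf.injOn (Function.invFunOn_mem hex) hL0
      ((Function.invFunOn_eq hex).trans hfL.symm)
  rw [hinv]
  -- A nonempty super arm yields `m ≥ 1`, which removes round 1 from the series, and `K ≥ 1`, needed
  -- for the width estimate.
  obtain ⟨S, hS, j, hj⟩ := B.nonempty_of_bad hα hbad
  have hm : 1 ≤ m := j.pos
  have hK : 1 ≤ K := (Finset.card_pos.2 ⟨j, hj⟩).trans_le (hcard S hS)
  have hΔ := B.gapMax_nonneg (α := α)
  set b := 128 * K * Real.log (1.25 / δ) * Real.log T / (min (ε ^ 2) 2 * L ^ 2) with hbdef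
  have hlogδ : 0 ≤ Real.log (1.25 / δ) := by
    refine Real.log_nonneg ?_
    rw [le_div_iff₀ hδ0]
    linarith
  have hb : 0 ≤ b := by
    have := Real.log_natCast_nonneg T
    have : 0 < min (ε ^ 2) 2 := lt_min (by positivity) (by norm_num)
    positivity
  have hround : ∀ n ∈ Finset.range T, α * β * B.opt B.mean
      - ∫ ω, B.reward (play K ε δ init O (fun n => X n ω) (n + 1)) B.mean ∂μ
      ≤ B.gapMax α * ((if n + 1 ≤ m then 1 else 0)
        + if n + 1 ≤ m then 0 else ∫ ω, charge B K ε δ init O b (n + 1)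
          (state K ε δ init O (fun n => X n ω) n, (X (n + 1) ω).2.2) ∂μ) := by
    intro n hn
    split_ifs with h
    · rw [add_zero, mul_one]
      exact regret_round_le hα0 hβ hO hinit hX n
    · have h1 := integral_play_ge (init := init) hα0 hβ hε hδ0 hδ hK hf hsm hL hfL hO hX hind hlaw
        h (Finset.mem_range.1 hn)
      rw [integral_add (integrable_reward_play hO.meas hX n)
        ((integrable_charge hO.meas hX _ n).const_mul _), integral_const_mul] at h1
      rw [← hbdef] at h1
      rw [zero_add]
      linarith
  have hinitsum : ∑ n ∈ Finset.range T, (if n + 1 ≤ m then (1 : ℝ) else 0) ≤ m := by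
    rw [Finset.sum_boole]
    have : (Finset.range T).filter (fun n => n + 1 ≤ m) ⊆ Finset.range m := fun n hn => by
      simp only [Finset.mem_filter, Finset.mem_range] at hn ⊢
      omega
    exact_mod_cast (Finset.card_le_card this).trans (Finset.card_range m).le
  have hsum := Finset.sum_le_sum hround
  rw [← Finset.mul_sum, Finset.sum_add_distrib] at hsum
  refine hsum.trans ?_
  have := add_le_add hinitsum
    (sum_integral_charge_le (init := init) hm hO.meas hX hind hlaw hb T)
  calc _ ≤ B.gapMax α * (m + (b + Real.pi ^ 2 / 3) * m) := mul_le_mul_of_nonneg_left this hΔ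
    _ = _ := by ring

end Path

end CUCB

/-! ### The asymptotic form of the bound and the main theorem. -/

/-- The constant of the asymptotic regret bound. -/
noncomputable def regretConst (ε₀ δ₀ L D : ℝ) : ℝ :=
  D * (128 * (1 + 1 / Real.log (1 / δ₀)) * (1 + ε₀ ^ 2) / L ^ 2
    + (Real.pi ^ 2 / 3 + 1) * ε₀ ^ 2 / (Real.log (1 / δ₀) * Real.log 2))

/-- The restrictions keep `log (1/δ)`, `log T` and `1/ε ^ 2` bounded below by positive constants.
Hence `log 1.25` and `π ^ 2 / 3 + 1` are absorbed, and `1 / min (ε ^ 2) 2` is comparable to `1 / ε ^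
2`. -/
theorem regret_bound_le_const {m K T : ℕ} {ε δ ε₀ δ₀ L D : ℝ} (hK : 1 ≤ K) (hD : 0 ≤ D)
    (hε : 0 < ε) (hδ : 0 < δ) (hδ₀ : δ₀ < 1) (hεε₀ : ε ≤ ε₀) (hδδ₀ : δ ≤ δ₀) (hT : 2 ≤ T) :
    (128 * K * Real.log (1.25 / δ) * Real.log T / (min (ε ^ 2) 2 * L ^ 2)
        + Real.pi ^ 2 / 3 + 1) * m * D
      ≤ regretConst ε₀ δ₀ L D * (m * K * Real.log (1 / δ) * Real.log T / ε ^ 2) := by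
  have hδ₀0 : 0 < δ₀ := hδ.trans_le hδδ₀
  have hl0 : 0 < Real.log (1 / δ₀) := Real.log_pos (by rw [lt_div_iff₀ hδ₀0]; linarith)
  have hl : Real.log (1 / δ₀) ≤ Real.log (1 / δ) :=
    Real.log_le_log (by positivity) (one_div_le_one_div_of_le hδ hδδ₀)
  have h2 : 0 < Real.log 2 := Real.log_pos (by norm_num)
  have hT2 : Real.log 2 ≤ Real.log T := Real.log_le_log (by norm_num) (mod_cast hT)
  have hK' : (1 : ℝ) ≤ K := mod_cast hK
  have h125 : Real.log (1.25 / δ) ≤ (1 + 1 / Real.log (1 / δ₀)) * Real.log (1 / δ) := by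
    have e : Real.log (1.25 / δ) = Real.log 1.25 + Real.log (1 / δ) := by
      rw [← Real.log_mul (by norm_num) (by positivity)]; congr 1; ring
    have h1 : Real.log 1.25 ≤ 1 := by
      have := Real.log_le_sub_one_of_pos (x := 1.25) (by norm_num)
      linarith
    have h3 : 1 ≤ 1 / Real.log (1 / δ₀) * Real.log (1 / δ) := by
      rw [one_div_mul_eq_div, le_div_iff₀ hl0]; linarith
    rw [e]; linarith
  have hε2 : ε ^ 2 ≤ ε₀ ^ 2 := pow_le_pow_left₀ hε.le hεε₀ 2
  have hmin0 : 0 < min (ε ^ 2) 2 := lt_min (by positivity) (by norm_num)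
  have hmin : 1 / min (ε ^ 2) 2 ≤ (1 + ε₀ ^ 2) / ε ^ 2 := by
    rw [div_le_div_iff₀ hmin0 (by positivity)]
    rcases min_cases (ε ^ 2) 2 with ⟨h, _⟩ | ⟨h, _⟩ <;> rw [h] <;> nlinarith [sq_nonneg ε₀]
  have hlogT : 0 < Real.log T := h2.trans_le hT2
  have hlδ : 0 < Real.log (1 / δ) := hl0.trans_le hl
  have hA : 128 * K * Real.log (1.25 / δ) * Real.log T / (min (ε ^ 2) 2 * L ^ 2)
      ≤ 128 * (1 + 1 / Real.log (1 / δ₀)) * (1 + ε₀ ^ 2) / L ^ 2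
        * (K * Real.log (1 / δ) * Real.log T / ε ^ 2) := by
    calc 128 * K * Real.log (1.25 / δ) * Real.log T / (min (ε ^ 2) 2 * L ^ 2)
        = 128 * K * Real.log T * (1 / L ^ 2)
          * (Real.log (1.25 / δ) * (1 / min (ε ^ 2) 2)) := by
          rw [div_mul_eq_div_mul_one_div]; ring
      _ ≤ 128 * K * Real.log T * (1 / L ^ 2)
          * ((1 + 1 / Real.log (1 / δ₀)) * Real.log (1 / δ) * ((1 + ε₀ ^ 2) / ε ^ 2)) := by
          gcongr
      _ = _ := by ring
  have hB : Real.pi ^ 2 / 3 + 1 ≤ (Real.pi ^ 2 / 3 + 1) * ε₀ ^ 2 / (Real.log (1 / δ₀) * Real.log 2)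
      * (K * Real.log (1 / δ) * Real.log T / ε ^ 2) := by
    rw [div_mul_div_comm, le_div_iff₀ (by positivity)]
    have h : Real.log (1 / δ₀) * Real.log 2 * ε ^ 2
        ≤ ε₀ ^ 2 * (K * Real.log (1 / δ) * Real.log T) := by
      calc Real.log (1 / δ₀) * Real.log 2 * ε ^ 2
          ≤ Real.log (1 / δ) * Real.log T * ε₀ ^ 2 := by gcongr
        _ ≤ K * (Real.log (1 / δ) * Real.log T * ε₀ ^ 2) :=
            le_mul_of_one_le_left (by positivity) hK'
        _ = _ := by ring
    have := mul_le_mul_of_nonneg_left h (by positivity : 0 ≤ Real.pi ^ 2 / 3 + 1)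
    linarith
  have h := mul_le_mul_of_nonneg_right (add_le_add hA hB)
    (mul_nonneg (Nat.cast_nonneg m : (0 : ℝ) ≤ m) hD)
  rw [regretConst]
  calc _ ≤ _ := le_of_eq (by ring)
    _ ≤ _ := h
    _ = _ := by ring


theorem theorem9 :
    ∃ C : ℝ → ℝ → ℝ → ℝ → ℝ,
      ∀ (m : ℕ) (B : SemiBandit m) (f : ℝ → ℝ) (α β : ℝ) (K : ℕ) (ε δ : ℝ)
        (Ξ : Type*) [MeasurableSpace Ξ] (ν : Measure Ξ) [IsProbabilityMeasure ν]
        (O : (Fin m → ℝ) → Ξ → Finset (Fin m)) (init : ℕ → Finset (Fin m))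
        (Ω : Type*) [MeasurableSpace Ω] (μ : Measure Ω) [IsProbabilityMeasure μ]
        (X : ℕ → Ω → CUCB.Sample m Ξ),
        0 < α → α ≤ 1 → 0 < β → β ≤ 1 → 0 < ε → 0 < δ → δ < 1 →
        (∀ S ∈ B.superArms, S.card ≤ K) →
        StrictMonoOn f (Set.Ici 0) → B.BoundedSmooth f →
        ((B.bad α).Nonempty → B.gapMin α ∈ f '' Set.Ioi 0) →
        B.IsOracle ν α β O →
        (∀ t, init t ∈ B.superArms) →
        (∀ t, Measurable (X t)) → iIndepFun X μ →
        (∀ t, μ.map (X t) = CUCB.sampleLaw B K ε δ ν) →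
        ∀ T : ℕ,
          CUCB.regret B α β K ε δ init O μ X T ≤
              (128 * K * Real.log (1.25 / δ) * Real.log T
                  / (min (ε ^ 2) 2 * smoothInv f (B.gapMin α) ^ 2)
                + Real.pi ^ 2 / 3 + 1) * m * B.gapMax α ∧
          ∀ ε₀ δ₀ : ℝ, δ₀ < 1 → ε ≤ ε₀ → δ ≤ δ₀ → 2 ≤ T →
            CUCB.regret B α β K ε δ init O μ X T ≤
              C ε₀ δ₀ (smoothInv f (B.gapMin α)) (B.gapMax α)
                * (m * K * Real.log (1 / δ) * Real.log T / ε ^ 2) := by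
  refine ⟨regretConst, ?_⟩
  intro m B f α β K ε δ Ξ _ ν _ O init Ω _ μ _ X hα0 hα hβ0 hβ hε hδ0 hδ hcard hf hsm hgap hO hinit
    hX hind hlaw T
  have h := CUCB.regret_le hα0 hα hβ hε hδ0 hδ hcard hf hsm hgap hO hinit hX hind hlaw T
  refine ⟨h, fun ε₀ δ₀ hδ₀ hεε₀ hδδ₀ hT => h.trans ?_⟩
  by_cases hbad : (B.bad α).Nonempty
  · obtain ⟨S, hS, j, hj⟩ := B.nonempty_of_bad hα hbad
    have hK : 1 ≤ K := (Finset.card_pos.2 ⟨j, hj⟩).trans_le (hcard S hS)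
    exact regret_bound_le_const hK B.gapMax_nonneg hε hδ0 hδ₀ hεε₀ hδδ₀ hT
  -- Here `K` may be 0, but both sides vanish with the largest gap.
  · simp [regretConst, B.gapMax_eq_zero hbad]
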